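/- Let $A$ and $B$ be (nonzero) finite-dimensional quantum systems, let $A'$ be a copy of $A$, and write $\mathcal D(\mathcal H)$ for the density operators on $\mathcal H$. Let $\mathcal N_{A\to B}$ be a quantum channel (a completely positive trace-preserving map). For $\rho_{A'}\in\mathcal D(\mathcal H_{A'})$ let $$|\rho\rangle\langle\rho|_{A'A}=(\sqrt{\rho_{A'}}\otimes I_A)\,|\gamma\rangle\langle\gamma|\,(\sqrt{\rho_{A'}}\otimes I_A),\qquad |\gamma\rangle=\sum_i|i\rangle_{A'}|i\rangle_A,$$ be its canonical purification, and let $\rho_{A'B}=(\mathrm{id}_{A'}\otimes\mathcal N_{A\to B})(|\rho\rangle\langle\rho|_{A'A})$. Let $F(\varrho,\varsigma)=\bigl(\operatorname{tr}\sqrt{\varrho^{1/2}\varsigma\varrho^{1/2}}\bigr)^2$ be the fidelity, let $\log$ be the natural logarithm, and let $D_{\max}(\varrho\|\varsigma)=\inf\{r\in\mathbb R:\varrho\le e^{r}\varsigma\}$ (with $\inf\emptyset=+\infty$). For $\varepsilon\in(0,1)$ let $$D_{\max}^{\varepsilon,A'}(\varrho_{A'B}\|\varsigma_{A'B})=\inf\bigl\{D_{\max}(\tilde\varrho_{A'B}\|\varsigma_{A'B})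 : \tilde\varrho_{A'B}\in\mathcal D(\mathcal H_{A'B}),\ \tilde\varrho_{A'}=\varrho_{A'},\ F(\tilde\varrho_{A'B},\varrho_{A'B})\ge 1-\varepsilon^2\bigr\}.$$ For an integer $M\ge 1$, an eLOCC protocol from $A$ to $B$ with alphabet size $M$ is a map of the form $$\tilde{\mathcal N}_{A\to B}:\ \rho_A\mapsto\sum_{m=1}^{M}\Phi^{(m)}_{K\to B}\Bigl(\operatorname{tr}_{AK'}\bigl[(E_m\otimes I_K)(\rho_A\otimes|\sigma\rangle\langle\sigma|_{KK'})\bigr]\Bigr),$$ where $K,K'$ are finite-dimensional systems of equal dimension, $|\sigma\rangle_{KK'}$ is a pure state (unit vector), $\{E_m\}_{m=1}^M$ is a POVM on $AK'$, and each $\Phi^{(m)}_{K\to B}$ is a quantum channel. Let $0<\delta<\epsilon<1$ and let $M\ge 1$ be an integer such that $$\log M\ \ge\ \sup_{\rho_{A'}\in\mathcal D(\mathcal H_{A'})}\ \inf_{\sigma_B\in\mathcal D(\mathcal H_B)} D_{\max}^{\epsilon-\delta,A'}\bigl(\rho_{A'B}\,\big\|\,\rho_{A'}\otimes\sigma_B\bigr)-\log\delta^2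 .$$ Then there exists an eLOCC protocol $\tilde{\mathcal N}_{A\to B}$ with alphabet size $M$ that simulates $\mathcal N_{A\to B}$ with fidelity at least $1-\epsilon^2$, i.e., such that for every $\rho_{A'}\in\mathcal D(\mathcal H_{A'})$ $$F\bigl((\mathrm{id}_{A'}\otimes\mathcal N)(|\rho\rangle\langle\rho|_{A'A}),\,(\mathrm{id}_{A'}\otimes\tilde{\mathcal N})(|\rho\rangle\langle\rho|_{A'A})\bigr)\ \ge\ 1-\epsilon^2 .$$ -/

import Mathlib

open scoped Kronecker MatrixOrder ComplexOrder

noncomputable section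

namespace ChannelSim

/-- Density operators on the Hilbert space `ℂ^n`: positive semidefinite with unit trace. -/
def density (n : Type*) [Fintype n] : Set (Matrix n n ℂ) :=
  {ρ | ρ.PosSemidef ∧ ρ.trace = 1}

/-- Partial trace over the first tensor factor. -/
def trLeft {m n : Type*} [Fintype m] (X : Matrix (m × n) (m × n) ℂ) : Matrix n n ℂ :=
  Matrix.of fun j j' => ∑ i, X (i, j) (i, j')

/-- Partial trace over the second tensor factor. -/
def trRight {m n : Type*} [Fintype n] (X : Matrix (m × n) (m × n) ℂ) : Matrix m m ℂ :=
  Matrix.of fun i i' => ∑ j, X (i, j) (i', j)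

/-- The map `id_R ⊗ T`: `T` acts on each block `⟨r| X |r'⟩` of `X`. -/
def idTensor (R : Type*) {A B : Type*} (T : Matrix A A ℂ →ₗ[ℂ] Matrix B B ℂ)
    (X : Matrix (R × A) (R × A) ℂ) : Matrix (R × B) (R × B) ℂ :=
  Matrix.of fun p q => T (Matrix.of fun a a' => X (p.1, a) (q.1, a')) p.2 q.2

/-- Quantum channels: completely positive trace-preserving linear maps. -/
structure IsChannel {A B : Type*} [Fintype A] [Fintype B]
    (T : Matrix A A ℂ →ₗ[ℂ] Matrix B B ℂ) : Prop where
  completelyPositive : ∀ (d : ℕ) (X : Matrix (Fin d × A) (Fin d × A) ℂ),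
    X.PosSemidef → (idTensor (Fin d) T X).PosSemidef
  tracePreserving : ∀ X : Matrix A A ℂ, (T X).trace = X.trace

/-- The rank-one operator `|ψ⟩⟨ψ|`. -/
def proj {n : Type*} (ψ : n → ℂ) : Matrix n n ℂ :=
  Matrix.vecMulVec ψ (star ψ)

/-- The (unnormalized) maximally entangled vector `∑ i, |i⟩|i⟩`. -/
def maxEnt (A : Type*) [DecidableEq A] : A × A → ℂ :=
  fun p => if p.1 = p.2 then 1 else 0

/-- The canonical purification `(√ρ ⊗ I) |γ⟩⟨γ| (√ρ ⊗ I)` of `ρ`, on `A' ⊗ A`. -/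
def purification {A : Type*} [Fintype A] [DecidableEq A] (ρ : Matrix A A ℂ) :
    Matrix (A × A) (A × A) ℂ :=
  (CFC.sqrt ρ ⊗ₖ (1 : Matrix A A ℂ)) * proj (maxEnt A) * (CFC.sqrt ρ ⊗ₖ (1 : Matrix A A ℂ))

/-- The joint reference-output operator `ρ_{A'B} = (id_{A'} ⊗ T)(purification ρ)`. -/
def jointOutput {A B : Type*} [Fintype A] [DecidableEq A]
    (T : Matrix A A ℂ →ₗ[ℂ] Matrix B B ℂ) (ρ : Matrix A A ℂ) : Matrix (A × B) (A × B) ℂ :=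
  idTensor A T (purification ρ)

/-- The fidelity `F(ρ, σ) = (tr √(√ρ σ √ρ))²`. -/
def fidelity {n : Type*} [Fintype n] [DecidableEq n] (ρ σ : Matrix n n ℂ) : ℝ :=
  ((CFC.sqrt (CFC.sqrt ρ * σ * CFC.sqrt ρ)).trace.re) ^ 2

/-- The max-divergence `inf {r : ρ ≤ exp r · σ}` in the Loewner order (natural units);
it is `⊤` when no such `r` exists. -/
def Dmax {n : Type*} (ρ σ : Matrix n n ℂ) : EReal :=
  ⨅ (r : ℝ) (_ : ((Real.exp r : ℂ) • σ - ρ).PosSemidef), (r : EReal)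

/-- The partially smoothed max-divergence, with the marginal on the first factor held fixed. -/
def smoothDmax {A B : Type*} [Fintype A] [DecidableEq A] [Fintype B] [DecidableEq B]
    (ε : ℝ) (ρ ς : Matrix (A × B) (A × B) ℂ) : EReal :=
  ⨅ (τ : Matrix (A × B) (A × B) ℂ)
    (_ : τ ∈ density (A × B) ∧ trRight τ = trRight ρ ∧ 1 - ε ^ 2 ≤ fidelity τ ρ), Dmax τ ς

/-- The unnormalized state of Bob's system `K` after Alice applies the measurement operator `E`
to `A K'`: `tr_{AK'} [(E ⊗ I_K) (ρ_A ⊗ |ψ⟩⟨ψ|_{K'K})]`. -/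
def bobState {A K K' : Type*} [Fintype A] [Fintype K] [DecidableEq K] [Fintype K']
    (ψ : K' × K → ℂ) (E : Matrix (A × K') (A × K') ℂ) (ρ : Matrix A A ℂ) : Matrix K K ℂ :=
  trLeft ((E ⊗ₖ (1 : Matrix K K ℂ)) *
    (ρ ⊗ₖ proj ψ).submatrix (Equiv.prodAssoc A K' K) (Equiv.prodAssoc A K' K))

/-- The set of eLOCC protocols from `A` to `B` with alphabet size `M`: a shared pure entangled
state `ψ` on two finite-dimensional systems of equal dimension, a POVM `E` of Alice with `M`
outcomes, and a channel `Φ m` of Bob for each message `m`. -/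
def eLOCC (A B : Type*) [Fintype A] [DecidableEq A] [Fintype B] (M : ℕ) :
    Set (Matrix A A ℂ →ₗ[ℂ] Matrix B B ℂ) :=
  {T | ∃ (d : ℕ) (ψ : Fin d × Fin d → ℂ)
      (E : Fin M → Matrix (A × Fin d) (A × Fin d) ℂ)
      (Φ : Fin M → (Matrix (Fin d) (Fin d) ℂ →ₗ[ℂ] Matrix B B ℂ)),
      ∑ p, ‖ψ p‖ ^ 2 = 1 ∧
      (∀ m, (E m).PosSemidef) ∧ ∑ m, E m = 1 ∧
      (∀ m, IsChannel (Φ m)) ∧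
      ∀ ρ, T ρ = ∑ m, Φ m (bobState ψ (E m) ρ)}

end ChannelSim

end

/-!
Fix a channel `N` and an input `ρ`, and let `τ` be a smoothed joint output with the marginal of
`ρ` on the reference and `τ ≤ k (ρ ⊗ σ)`. Alice and Bob share `M` copies of a purification of `σ`.
Alice measures so that, for the outcome `m`, the reference together with Bob's `m`-th copy is close
to `τ`; she sends `m` and Bob keeps that copy. Such a measurement exists because the *convex split*
`Γ`, the average over `m` of the states with `τ` in slot `m` and `σ` in all the other slots, is
close to `S = ρ ⊗ σ^{⊗M}`, which is the actual state of the reference and Bob's copies.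

The pretty good measurement `Γ^{-1/2} (τ_m / M) Γ^{-1/2}` already suffices, so that Uhlmann's theorem
is not needed at this point: its output has root fidelity at least `tr (√Γ √S)` with `τ`. A trace
version of `√(p q) ≥ (3 p - p² / q) / 2` bounds this below by `(3 - tr (Γ S⁻¹ Γ)) / 2`
(`re_trace_mul_ge`). In `tr (Γ S⁻¹ Γ)` the cross terms equal `1`, since `τ` has the same
reference marginal as `ρ ⊗ σ`, and the diagonal terms are at most `k`
(`re_trace_convexSplit_le`). Hence the root fidelity with `τ` is at least `1 - k / (2 M)`
(`exists_measurement`). With `k` close to `M δ²` this is about `1 - δ² / 2 ≥ √(1 - δ²)`, and the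
triangle inequality for the angle of the root fidelity (`rootFidelity_triangle`) combines it with
the smoothing error `ε - δ` to the error `ε`. Inverses are harmless after `σ` and `τ` are mixed
with strictly positive operators of small weight, and `ρ` with the maximally mixed state.

The protocol obtained so far depends on `ρ`. The root fidelity of the joint outputs is convex in
`ρ` (it is the maximum over unitaries `U` of `Re tr (U √J (ρ ⊗ 1) √J')`, where `J` and `J'` are the
Choi matrices) and concave in `J'`. For fixed `M` the protocols above use systems of fixed dimension
and therefore have a compact set of Choi matrices; so has its convex hull, which consists of Choi
matrices of eLOCC protocols because shared entanglement supplies shared randomness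
(`combo_mem_eLOCC`). Sion's minimax theorem then gives one protocol that works for all `ρ`
(`exists_eLOCC_of_forall_input`); compactness also makes the optimum attained, so that approximate
protocols for each `ρ` are enough.
-/

set_option linter.unusedSectionVars false

noncomputable section

namespace ChannelSim

open Matrix

/-! ### Polar decomposition -/

section Polar

variable {m n : Type*} [Fintype m] [Fintype n] [DecidableEq m] [DecidableEq n]

/-- Two linear maps with equal norms pointwise differ by an isometry of the target, obtained by
extending the isometry between their ranges. -/
lemma exists_linearIsometry_comp_eq {E F : Type*} [NormedAddCommGroup E] [InnerProductSpace ℂ E]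
    [NormedAddCommGroup F] [InnerProductSpace ℂ F] [FiniteDimensional ℂ F]
    (G H : E →ₗ[ℂ] F) (h : ∀ x, ‖G x‖ = ‖H x‖) :
    ∃ L : F →ₗᵢ[ℂ] F, ∀ x, G x = L (H x) := by
  obtain ⟨s, hs⟩ := H.rangeRestrict.exists_rightInverse_of_surjective H.range_rangeRestrict
  have hs' : ∀ y : LinearMap.range H, H (s y) = y := fun y => by
    have := LinearMap.congr_fun hs y
    simpa using congrArg Subtype.val this
  let f : LinearMap.range H →ₗᵢ[ℂ] F :=
    { toLinearMap := G ∘ₗ s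
      norm_map' := fun y => by
        rw [LinearMap.comp_apply, h, hs']; rfl }
  refine ⟨f.extend, fun x => ?_⟩
  have h1 := f.extend_apply ⟨H x, LinearMap.mem_range_self H x⟩
  simp only at h1
  rw [h1]
  have h2 : ‖G (x - s ⟨H x, LinearMap.mem_range_self H x⟩)‖ = 0 := by
    rw [h, map_sub, hs', sub_self, norm_zero]
  rw [norm_eq_zero, map_sub, sub_eq_zero] at h2
  exact h2

/-- Polar decomposition: two matrices with the same Gram matrix differ by a unitary. -/
lemma exists_unitary_mul_eq (G H : Matrix m n ℂ) (h : Gᴴ * G = Hᴴ * H) :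
    ∃ U : Matrix m m ℂ, Uᴴ * U = 1 ∧ U * Uᴴ = 1 ∧ G = U * H := by
  have key : ∀ (G : Matrix m n ℂ) (x : EuclideanSpace ℂ n),
      ((‖G.toEuclideanLin x‖ ^ 2 : ℝ) : ℂ) = star x.ofLp ⬝ᵥ (Gᴴ * G) *ᵥ x.ofLp := by
    intro G x
    have := inner_self_eq_norm_sq_to_K (𝕜 := ℂ) (G.toEuclideanLin x)
    push_cast
    refine this.symm.trans ?_
    rw [EuclideanSpace.inner_eq_star_dotProduct]
    simp only [Matrix.ofLp_toLpLin, Matrix.toLin'_apply]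
    rw [← mulVec_mulVec, star_mulVec, dotProduct_comm, dotProduct_mulVec, dotProduct_mulVec]
    simp [← dotProduct_mulVec]
  have hn : ∀ x, ‖G.toEuclideanLin x‖ = ‖H.toEuclideanLin x‖ := by
    intro x
    have h1 := key G x
    rw [h, ← key H x] at h1
    have h2 : ‖G.toEuclideanLin x‖ ^ 2 = ‖H.toEuclideanLin x‖ ^ 2 := by exact_mod_cast h1
    exact (sq_eq_sq₀ (norm_nonneg _) (norm_nonneg _)).1 h2
  obtain ⟨L, hL⟩ := exists_linearIsometry_comp_eq _ _ hn
  let U : Matrix m m ℂ := Matrix.toEuclideanLin.symm L.toLinearMap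
  have hU : U.toEuclideanLin = L.toLinearMap := LinearEquiv.apply_symm_apply _ _
  have hUU : Uᴴ * U = 1 := by
    ext i j
    have h1 := L.inner_map_map (EuclideanSpace.single i 1) (EuclideanSpace.single j 1)
    have h2 : ∀ j, L (EuclideanSpace.single j (1 : ℂ)) = U.toEuclideanLin (EuclideanSpace.single j 1) :=
      fun j => by rw [hU]; rfl
    rw [h2, h2, EuclideanSpace.inner_eq_star_dotProduct, EuclideanSpace.inner_eq_star_dotProduct] at h1
    simp at h1
    rw [Matrix.mul_apply, Matrix.one_apply]
    simp only [dotProduct, col_apply, Pi.star_apply] at h1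
    simp only [conjTranspose_apply]
    rw [Finset.sum_congr rfl (fun _ _ => mul_comm _ _), h1]
    simp [Pi.single_apply]
  refine ⟨U, hUU, mul_eq_one_comm.1 hUU, ?_⟩
  apply Matrix.toEuclideanLin.injective
  ext1 x
  rw [hL]
  have : (U * H).toEuclideanLin x = U.toEuclideanLin (H.toEuclideanLin x) := by
    simp [Matrix.toLpLin_apply]
  rw [this, hU]; rfl

/-- Polar decomposition of a rectangular matrix: a factor `X` of `R Rᴴ` is `R` times a contraction.
The contraction is an off-diagonal block of a unitary that relates the two matrices after padding
with zeros. -/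
lemma exists_eq_mul_of_mul_conjTranspose (R : Matrix m m ℂ) (X : Matrix m n ℂ)
    (h : X * Xᴴ = R * Rᴴ) :
    ∃ V : Matrix m n ℂ, X = R * V ∧ (1 - V * Vᴴ).PosSemidef := by
  obtain ⟨U, hU, -, hGH⟩ := exists_unitary_mul_eq (fromRows Xᴴ (0 : Matrix m m ℂ))
    (fromRows (0 : Matrix n m ℂ) Rᴴ) (by
      rw [conjTranspose_fromRows_eq_fromCols_conjTranspose,
        conjTranspose_fromRows_eq_fromCols_conjTranspose, fromCols_mul_fromRows,
        fromCols_mul_fromRows]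
      simp [h])
  have hb := fromBlocks_toBlocks U
  rw [← hb, fromBlocks_mul_fromRows] at hGH
  have h1 : Xᴴ = U.toBlocks₁₂ * Rᴴ := by simpa using (fromRows_inj hGH).1
  refine ⟨U.toBlocks₁₂ᴴ, ?_, ?_⟩
  · rw [← conjTranspose_conjTranspose X, h1, conjTranspose_mul, conjTranspose_conjTranspose]
  · rw [← hb, fromBlocks_conjTranspose, fromBlocks_multiply, ← fromBlocks_one,
      fromBlocks_inj] at hU
    rw [← hU.2.2.2, conjTranspose_conjTranspose, add_sub_cancel_left]
    exact posSemidef_conjTranspose_mul_self _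

end Polar

/-! ### The Hilbert–Schmidt form -/

section TraceForm

variable {n : Type*} [Fintype n]

lemma re_trace_nonneg {P : Matrix n n ℂ} (hP : P.PosSemidef) : 0 ≤ P.trace.re :=
  (Complex.nonneg_iff.1 hP.trace_nonneg).1

lemma re_trace_conjTranspose (X : Matrix n n ℂ) : Xᴴ.trace.re = X.trace.re := by
  rw [trace_conjTranspose]; simp

lemma two_mul_re_trace_le {m : Type*} [Fintype m] (X Y : Matrix n m ℂ) :
    2 * (X * Yᴴ).trace.re ≤ (X * Xᴴ).trace.re + (Y * Yᴴ).trace.re := by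
  have h := re_trace_nonneg (posSemidef_self_mul_conjTranspose (X - Y))
  have h2 := re_trace_conjTranspose (X * Yᴴ)
  rw [conjTranspose_mul, conjTranspose_conjTranspose] at h2
  rw [conjTranspose_sub, Matrix.sub_mul, Matrix.mul_sub, Matrix.mul_sub] at h
  simp only [trace_sub, Complex.sub_re] at h
  linarith

lemma cauchySchwarz_trace (X Y : Matrix n n ℂ) :
    (X * Yᴴ).trace.re ^ 2 ≤ (X * Xᴴ).trace.re * (Y * Yᴴ).trace.re := by
  have h : ∀ s : ℝ, 0 ≤ (Y * Yᴴ).trace.re * (s * s) + 2 * (X * Yᴴ).trace.re * s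
      + (X * Xᴴ).trace.re := by
    intro s
    have := re_trace_nonneg (posSemidef_self_mul_conjTranspose (X + (s : ℂ) • Y))
    have h2 := re_trace_conjTranspose (X * Yᴴ)
    rw [conjTranspose_mul, conjTranspose_conjTranspose] at h2
    simp only [conjTranspose_add, conjTranspose_smul, Matrix.add_mul, Matrix.mul_add, trace_add,
      Complex.add_re, Matrix.smul_mul, Matrix.mul_smul, trace_smul, smul_eq_mul,
      Complex.star_def, Complex.conj_ofReal, Complex.re_ofReal_mul] at this
    rw [h2] at this
    linarith
  have := discrim_le_zero h
  unfold discrim at this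
  nlinarith

end TraceForm

/-! ### Root fidelity -/

section RootFidelity

variable {n J : Type*} [Fintype n] [DecidableEq n] [Fintype J]

/-- The root fidelity `tr √(√P Q √P)`. The trace is real, so taking the real part loses nothing. -/
def rootFidelity (P Q : Matrix n n ℂ) : ℝ :=
  (CFC.sqrt (CFC.sqrt P * Q * CFC.sqrt P)).trace.re

lemma fidelity_eq_sq (P Q : Matrix n n ℂ) : fidelity P Q = rootFidelity P Q ^ 2 := rfl

lemma sqrt_posSemidef (P : Matrix n n ℂ) : (CFC.sqrt P).PosSemidef :=
  nonneg_iff_posSemidef.1 (CFC.sqrt_nonneg P)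

lemma sqrt_conjTranspose (P : Matrix n n ℂ) : (CFC.sqrt P)ᴴ = CFC.sqrt P :=
  (sqrt_posSemidef P).isHermitian

lemma sqrt_mul_sqrt {P : Matrix n n ℂ} (hP : P.PosSemidef) : CFC.sqrt P * CFC.sqrt P = P :=
  CFC.sqrt_mul_sqrt_self P hP.nonneg

lemma rootFidelity_nonneg (P Q : Matrix n n ℂ) : 0 ≤ rootFidelity P Q :=
  re_trace_nonneg (sqrt_posSemidef _)

lemma posSemidef_sqrt_sandwich {P Q : Matrix n n ℂ} (hQ : Q.PosSemidef) :
    (CFC.sqrt P * Q * CFC.sqrt P).PosSemidef := by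
  have := hQ.mul_mul_conjTranspose_same (CFC.sqrt P)
  rwa [sqrt_conjTranspose] at this

/-- The polar decomposition of `√Q √P`, whose modulus is `√(√P Q √P)`. -/
lemma exists_unitary_sqrt_mul_sqrt {P Q : Matrix n n ℂ} (hQ : Q.PosSemidef) :
    ∃ W : Matrix n n ℂ, Wᴴ * W = 1 ∧ W * Wᴴ = 1 ∧
      CFC.sqrt Q * CFC.sqrt P = W * CFC.sqrt (CFC.sqrt P * Q * CFC.sqrt P) := by
  apply exists_unitary_mul_eq
  rw [conjTranspose_mul, sqrt_conjTranspose, sqrt_conjTranspose, sqrt_conjTranspose,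
    sqrt_mul_sqrt (posSemidef_sqrt_sandwich hQ)]
  calc _ = CFC.sqrt P * (CFC.sqrt Q * CFC.sqrt Q) * CFC.sqrt P := by simp only [Matrix.mul_assoc]
    _ = _ := by rw [sqrt_mul_sqrt hQ]

/-- The easy half of Uhlmann's theorem: any simultaneous factorization of two operators bounds their
root fidelity from below. The size of the purifying system `J` is arbitrary. -/
theorem re_trace_le_rootFidelity [DecidableEq J] (X Y : Matrix n J ℂ) :
    (X * Yᴴ).trace.re ≤ rootFidelity (X * Xᴴ) (Y * Yᴴ) := by
  set P := X * Xᴴ with hP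
  set Q := Y * Yᴴ with hQ
  have hP0 : P.PosSemidef := posSemidef_self_mul_conjTranspose X
  have hQ0 : Q.PosSemidef := posSemidef_self_mul_conjTranspose Y
  obtain ⟨V₁, hX, hV₁⟩ := exists_eq_mul_of_mul_conjTranspose (CFC.sqrt P) X
    (by rw [sqrt_conjTranspose, sqrt_mul_sqrt hP0])
  obtain ⟨V₂, hY, hV₂⟩ := exists_eq_mul_of_mul_conjTranspose (CFC.sqrt Q) Y
    (by rw [sqrt_conjTranspose, sqrt_mul_sqrt hQ0])
  obtain ⟨W, hW, -, hWH⟩ := exists_unitary_sqrt_mul_sqrt (P := P) hQ0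
  unfold rootFidelity
  -- with `√Q √P = W H` the trace is an inner product of `√H V₁` and `√H Wᴴ V₂`, where `V₁`, `V₂` are
  -- contractions, and Cauchy–Schwarz bounds it by `tr H`
  set H := CFC.sqrt (CFC.sqrt P * Q * CFC.sqrt P) with hH
  have hH0 : H.PosSemidef := sqrt_posSemidef _
  set h := CFC.sqrt H with hh
  have hhh : h * h = H := sqrt_mul_sqrt hH0
  have hhc : hᴴ = h := sqrt_conjTranspose H
  have e1 : (X * Yᴴ).trace = ((h * V₁) * (h * (Wᴴ * V₂))ᴴ).trace := by
    calc (X * Yᴴ).trace = (CFC.sqrt P * (V₁ * V₂ᴴ * CFC.sqrt Q)).trace := by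
          conv_lhs => rw [hX, hY]
          rw [conjTranspose_mul, sqrt_conjTranspose]; simp only [Matrix.mul_assoc]
      _ = (V₁ * V₂ᴴ * (CFC.sqrt Q * CFC.sqrt P)).trace := by
          rw [trace_mul_comm]; simp only [Matrix.mul_assoc]
      _ = (V₁ * V₂ᴴ * W * h * h).trace := by
          rw [hWH, ← hhh]; simp only [Matrix.mul_assoc]
      _ = _ := by
          rw [trace_mul_comm]
          simp only [conjTranspose_mul, conjTranspose_conjTranspose, hhc, Matrix.mul_assoc]
  have e2 : ∀ V : Matrix n J ℂ, (1 - V * Vᴴ).PosSemidef →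
      (h * V * (h * V)ᴴ).trace.re ≤ H.trace.re := by
    intro V hV
    have := re_trace_nonneg (hV.mul_mul_conjTranspose_same h)
    rw [Matrix.mul_sub, Matrix.sub_mul, trace_sub, Complex.sub_re, Matrix.mul_one, hhc, hhh] at this
    rw [conjTranspose_mul, hhc]
    simp only [Matrix.mul_assoc] at this ⊢
    linarith
  have hV₃ : (1 - (Wᴴ * V₂) * (Wᴴ * V₂)ᴴ).PosSemidef := by
    have := hV₂.conjTranspose_mul_mul_same W
    rw [Matrix.mul_sub, Matrix.sub_mul, Matrix.mul_one, hW] at this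
    simpa [Matrix.mul_assoc] using this
  have := two_mul_re_trace_le (h * V₁) (h * (Wᴴ * V₂))
  rw [e1]
  linarith [e2 _ hV₁, e2 _ hV₃]

/-- The other half of Uhlmann's theorem: for square factors `X` and `Y` some unitary on the purifying
system attains the root fidelity. -/
theorem exists_unitary_rootFidelity_eq (X Y : Matrix n n ℂ) :
    ∃ U : Matrix n n ℂ, Uᴴ * U = 1 ∧ U * Uᴴ = 1 ∧
      (U * (Xᴴ * Y)).trace.re = rootFidelity (X * Xᴴ) (Y * Yᴴ) := by
  set P := X * Xᴴ with hP
  set Q := Y * Yᴴ with hQ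
  have hP0 : P.PosSemidef := posSemidef_self_mul_conjTranspose X
  have hQ0 : Q.PosSemidef := posSemidef_self_mul_conjTranspose Y
  obtain ⟨V₁, hV₁, hV₁', hX⟩ := exists_unitary_mul_eq Xᴴ (CFC.sqrt P)
    (by rw [sqrt_conjTranspose, sqrt_mul_sqrt hP0, conjTranspose_conjTranspose])
  obtain ⟨V₂, hV₂, hV₂', hY⟩ := exists_unitary_mul_eq Yᴴ (CFC.sqrt Q)
    (by rw [sqrt_conjTranspose, sqrt_mul_sqrt hQ0, conjTranspose_conjTranspose])
  obtain ⟨W, hW, hW', hWH⟩ := exists_unitary_sqrt_mul_sqrt (P := P) hQ0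
  have hWH' := congrArg conjTranspose hWH
  simp only [conjTranspose_mul, sqrt_conjTranspose] at hWH'
  have hY' : Y = CFC.sqrt Q * V₂ᴴ := by
    rw [← conjTranspose_conjTranspose Y, hY, conjTranspose_mul, sqrt_conjTranspose]
  refine ⟨V₂ * W * V₁ᴴ, ?_, ?_, ?_⟩
  · simp only [conjTranspose_mul, conjTranspose_conjTranspose]
    calc _ = V₁ * (Wᴴ * (V₂ᴴ * V₂) * W) * V₁ᴴ := by simp only [Matrix.mul_assoc]
      _ = 1 := by simp [hV₂, hW, hV₁']
  · simp only [conjTranspose_mul, conjTranspose_conjTranspose]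
    calc _ = V₂ * (W * (V₁ᴴ * V₁) * Wᴴ) * V₂ᴴ := by simp only [Matrix.mul_assoc]
      _ = 1 := by simp [hV₁, hW', hV₂']
  · unfold rootFidelity
    set H := CFC.sqrt (CFC.sqrt P * Q * CFC.sqrt P) with hH
    have hc : V₂ * W * V₁ᴴ * (Xᴴ * Y) = V₂ * (W * H * Wᴴ * V₂ᴴ) := by
      rw [hX]
      conv_lhs => rw [hY']
      calc _ = V₂ * W * (V₁ᴴ * V₁) * (CFC.sqrt P * CFC.sqrt Q) * V₂ᴴ := by
            simp only [Matrix.mul_assoc]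
        _ = _ := by rw [hV₁, hWH']; simp only [Matrix.mul_assoc, Matrix.mul_one]
    rw [hc, trace_mul_comm]
    have : W * H * Wᴴ * V₂ᴴ * V₂ = W * (H * Wᴴ) := by
      rw [Matrix.mul_assoc, hV₂, Matrix.mul_one, Matrix.mul_assoc]
    rw [this, trace_mul_comm, Matrix.mul_assoc, hW, Matrix.mul_one]

/-- Uhlmann's theorem, with the purification `X` of the first operator fixed. -/
theorem exists_purification_rootFidelity_eq {Q : Matrix n n ℂ} (X : Matrix n n ℂ)
    (hQ : Q.PosSemidef) :
    ∃ Y : Matrix n n ℂ, Y * Yᴴ = Q ∧ (X * Yᴴ).trace.re = rootFidelity (X * Xᴴ) Q := by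
  have hs : CFC.sqrt Q * (CFC.sqrt Q)ᴴ = Q := by rw [sqrt_conjTranspose, sqrt_mul_sqrt hQ]
  obtain ⟨U, hU, hU', h⟩ := exists_unitary_rootFidelity_eq X (CFC.sqrt Q)
  rw [hs] at h
  refine ⟨CFC.sqrt Q * U, ?_, ?_⟩
  · rw [conjTranspose_mul]
    calc _ = CFC.sqrt Q * (U * Uᴴ) * (CFC.sqrt Q)ᴴ := by simp only [Matrix.mul_assoc]
      _ = Q := by rw [hU', Matrix.mul_one, hs]
  · rw [← h, ← re_trace_conjTranspose, conjTranspose_mul, conjTranspose_conjTranspose,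
      trace_mul_comm, ← Matrix.mul_assoc, trace_mul_comm]

/-- The bound `re_trace_le_rootFidelity` for sums, obtained by placing the factors side by side. -/
theorem sum_re_trace_le_rootFidelity {ι : Type*} [Fintype ι] [DecidableEq ι] {J : ι → Type*}
    [∀ i, Fintype (J i)] [∀ i, DecidableEq (J i)] (X Y : ∀ i, Matrix n (J i) ℂ) :
    ∑ i, (X i * (Y i)ᴴ).trace.re ≤ rootFidelity (∑ i, X i * (X i)ᴴ) (∑ i, Y i * (Y i)ᴴ) := by
  have key : ∀ X Y : ∀ i, Matrix n (J i) ℂ,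
      (Matrix.of fun a (p : Σ i, J i) => X p.1 a p.2) *
        (Matrix.of fun a (p : Σ i, J i) => Y p.1 a p.2)ᴴ = ∑ i, X i * (Y i)ᴴ := by
    intro X Y
    ext a b
    simp [Matrix.mul_apply, Matrix.sum_apply, Fintype.sum_sigma]
  have := re_trace_le_rootFidelity (Matrix.of fun a (p : Σ i, J i) => X p.1 a p.2)
    (Matrix.of fun a (p : Σ i, J i) => Y p.1 a p.2)
  rw [key, key, key, trace_sum, Complex.re_sum] at this
  exact this

/-- Joint superadditivity of the root fidelity. -/
theorem sum_rootFidelity_le {ι : Type*} [Fintype ι] [DecidableEq ι] {P Q : ι → Matrix n n ℂ}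
    (hP : ∀ i, (P i).PosSemidef) (hQ : ∀ i, (Q i).PosSemidef) :
    ∑ i, rootFidelity (P i) (Q i) ≤ rootFidelity (∑ i, P i) (∑ i, Q i) := by
  have hs : ∀ i, CFC.sqrt (P i) * (CFC.sqrt (P i))ᴴ = P i := fun i => by
    rw [sqrt_conjTranspose, sqrt_mul_sqrt (hP i)]
  choose Y hY hXY using fun i => exists_purification_rootFidelity_eq (CFC.sqrt (P i)) (hQ i)
  have := sum_re_trace_le_rootFidelity (J := fun _ => n) (fun i => CFC.sqrt (P i)) Y
  simp only [hs, hY, hXY] at this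
  exact this

theorem rootFidelity_smul {P Q : Matrix n n ℂ} (hP : P.PosSemidef) (hQ : Q.PosSemidef)
    {a b : ℝ} (ha : 0 ≤ a) (hb : 0 ≤ b) :
    rootFidelity ((a : ℂ) • P) ((b : ℂ) • Q) = √a * √b * rootFidelity P Q := by
  have h1 : ∀ (a : ℝ) (_ : 0 ≤ a) (P : Matrix n n ℂ), P.PosSemidef →
      CFC.sqrt ((a : ℂ) • P) = ((√a : ℝ) : ℂ) • CFC.sqrt P := by
    intro a ha P hP
    apply CFC.sqrt_unique
    · rw [smul_mul_smul_comm, sqrt_mul_sqrt hP]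
      congr 1
      rw [← Complex.ofReal_mul, Real.mul_self_sqrt ha]
    · exact ((sqrt_posSemidef P).smul (by simp [Real.sqrt_nonneg])).nonneg
  unfold rootFidelity
  rw [h1 a ha P hP]
  have h2 : (((√a : ℝ) : ℂ) • CFC.sqrt P) * ((b : ℂ) • Q) * (((√a : ℝ) : ℂ) • CFC.sqrt P) =
      ((a * b : ℝ) : ℂ) • (CFC.sqrt P * Q * CFC.sqrt P) := by
    rw [smul_mul_smul_comm, smul_mul_smul_comm]
    congr 1
    have : ((√a : ℝ) : ℂ) * ((√a : ℝ) : ℂ) = a := by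
      rw [← Complex.ofReal_mul, Real.mul_self_sqrt ha]
    push_cast
    linear_combination (b : ℂ) * this
  rw [h2, h1 _ (by positivity) _ (posSemidef_sqrt_sandwich hQ), trace_smul, smul_eq_mul,
    Complex.re_ofReal_mul, Real.sqrt_mul ha]

lemma rootFidelity_comm {P Q : Matrix n n ℂ} (hP : P.PosSemidef) (hQ : Q.PosSemidef) :
    rootFidelity P Q = rootFidelity Q P := by
  have key : ∀ {P Q : Matrix n n ℂ}, P.PosSemidef → Q.PosSemidef →
      rootFidelity P Q ≤ rootFidelity Q P := by
    intro P Q hP hQ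
    have hs : CFC.sqrt P * (CFC.sqrt P)ᴴ = P := by rw [sqrt_conjTranspose, sqrt_mul_sqrt hP]
    obtain ⟨Y, hY, h⟩ := exists_purification_rootFidelity_eq (CFC.sqrt P) hQ
    have := re_trace_le_rootFidelity Y (CFC.sqrt P)
    rw [hs, hY] at this
    rw [hs, ← re_trace_conjTranspose, conjTranspose_mul, conjTranspose_conjTranspose] at h
    linarith
  exact le_antisymm (key hP hQ) (key hQ hP)

/-- Triangle inequality for the angle `arccos` of the root fidelity. -/
theorem rootFidelity_triangle {P Q R : Matrix n n ℂ} (hP : P ∈ density n) (hQ : Q ∈ density n)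
    (hR : R ∈ density n) {a b : ℝ} (ha : 0 ≤ a) (hb : 0 ≤ b)
    (hPQ : a ≤ rootFidelity P Q) (hQR : b ≤ rootFidelity Q R) :
    a * b - √(1 - a ^ 2) * √(1 - b ^ 2) ≤ rootFidelity P R := by
  have hs : CFC.sqrt Q * (CFC.sqrt Q)ᴴ = Q := by rw [sqrt_conjTranspose, sqrt_mul_sqrt hQ.1]
  obtain ⟨u, hu, hu'⟩ := exists_purification_rootFidelity_eq (CFC.sqrt Q) hP.1
  obtain ⟨w, hw, hw'⟩ := exists_purification_rootFidelity_eq (CFC.sqrt Q) hR.1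
  set v := CFC.sqrt Q with hv
  rw [hs] at hu' hw'
  rw [rootFidelity_comm hP.1 hQ.1, ← hu'] at hPQ
  rw [← hw'] at hQR
  have hF := re_trace_le_rootFidelity u w
  rw [hu, hw] at hF
  refine le_trans ?_ hF
  have tu : (u * uᴴ).trace.re = 1 := by rw [hu, hP.2]; simp
  have tv : (v * vᴴ).trace.re = 1 := by rw [hs, hQ.2]; simp
  have tw : (w * wᴴ).trace.re = 1 := by rw [hw, hR.2]; simp
  set α := (v * uᴴ).trace.re with hα
  set β := (v * wᴴ).trace.re with hβ
  have hα' : (u * vᴴ).trace.re = α := by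
    rw [hα, ← re_trace_conjTranspose, conjTranspose_mul, conjTranspose_conjTranspose]
  have hβ' : (w * vᴴ).trace.re = β := by
    rw [hβ, ← re_trace_conjTranspose, conjTranspose_mul, conjTranspose_conjTranspose]
  have exp : ∀ (x y : Matrix n n ℂ) (s t : ℝ),
      ((x - (s : ℂ) • v) * (y - (t : ℂ) • v)ᴴ).trace.re = (x * yᴴ).trace.re
        - t * (x * vᴴ).trace.re - s * (v * yᴴ).trace.re + s * t * (v * vᴴ).trace.re := by
    intro x y s t
    simp only [conjTranspose_sub, conjTranspose_smul, Matrix.sub_mul, Matrix.mul_sub, trace_sub,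
      Complex.sub_re, Matrix.smul_mul, Matrix.mul_smul, trace_smul, smul_eq_mul,
      Complex.star_def, Complex.conj_ofReal, Complex.re_ofReal_mul]
    ring
  -- Cauchy–Schwarz for the components of the purifications `u` and `w` orthogonal to `v`
  have h := cauchySchwarz_trace (u - (α : ℂ) • v) (w - (β : ℂ) • v)
  rw [exp, exp, exp, tu, tv, tw, hα', hβ', ← hα, ← hβ] at h
  have hα1 : α ^ 2 ≤ 1 := by
    have := cauchySchwarz_trace v u
    rw [← hα, tv, tu] at this; linarith
  have hβ1 : β ^ 2 ≤ 1 := by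
    have := cauchySchwarz_trace v w
    rw [← hβ, tv, tw] at this; linarith
  have h1 : -((u * wᴴ).trace.re - α * β) ≤ √(1 - α ^ 2) * √(1 - β ^ 2) := by
    rw [← Real.sqrt_mul (by linarith)]
    apply Real.le_sqrt_of_sq_le
    nlinarith
  have h2 : √(1 - α ^ 2) * √(1 - β ^ 2) ≤ √(1 - a ^ 2) * √(1 - b ^ 2) := by
    apply mul_le_mul <;> first | positivity | (apply Real.sqrt_le_sqrt; nlinarith)
  nlinarith [mul_le_mul hPQ hQR hb (ha.trans hPQ)]

end RootFidelity

/-! ### Continuity of the root fidelity -/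

section Continuity

variable {n : Type*} [Fintype n] [DecidableEq n]

open scoped Matrix.Norms.L2Operator in
lemma continuousOn_matrix_sqrt :
    ContinuousOn (CFC.sqrt : Matrix n n ℂ → Matrix n n ℂ) {P | P.PosSemidef} := by
  have : ContinuousOn (fun P : Matrix n n ℂ => cfc NNReal.sqrt P) {P | P.PosSemidef} :=
    ContinuousOn.cfc_nnreal_of_mem_nhdsSet (s := Set.univ) NNReal.sqrt Filter.univ_mem
      continuousOn_id (fun P hP => hP.nonneg) NNReal.continuous_sqrt.continuousOn
  refine this.congr fun P hP => ?_
  exact CFC.sqrt_eq_cfc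

lemma continuousOn_rootFidelity {X : Type*} [TopologicalSpace X] {s : Set X}
    {f g : X → Matrix n n ℂ} (hf : ContinuousOn f s) (hg : ContinuousOn g s)
    (hf0 : ∀ x ∈ s, (f x).PosSemidef) (hg0 : ∀ x ∈ s, (g x).PosSemidef) :
    ContinuousOn (fun x => rootFidelity (f x) (g x)) s := by
  have h1 : ContinuousOn (fun x => CFC.sqrt (f x)) s := continuousOn_matrix_sqrt.comp hf hf0
  have h2 : ContinuousOn (fun x => CFC.sqrt (CFC.sqrt (f x) * g x * CFC.sqrt (f x))) s :=
    continuousOn_matrix_sqrt.comp (f := fun x => CFC.sqrt (f x) * g x * CFC.sqrt (f x))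
      ((h1.mul hg).mul h1) (fun x hx => posSemidef_sqrt_sandwich (hg0 x hx))
  exact Complex.continuous_re.comp_continuousOn
    ((continuous_id.matrix_trace).comp_continuousOn h2)

end Continuity

/-! ### Joint outputs and Choi matrices -/

section Choi

variable {A B : Type*} [Fintype A] [DecidableEq A] [Fintype B] [DecidableEq B]

lemma purification_apply (ρ : Matrix A A ℂ) (r a r' a' : A) :
    purification ρ (r, a) (r', a') = CFC.sqrt ρ r a * CFC.sqrt ρ a' r' := by
  simp [purification, Matrix.mul_apply, Fintype.sum_prod_type, proj, vecMulVec_apply, maxEnt,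
    kroneckerMap_apply, Matrix.one_apply, mul_comm]

lemma jointOutput_apply (T : Matrix A A ℂ →ₗ[ℂ] Matrix B B ℂ) (ρ : Matrix A A ℂ) (r r' : A)
    (b b' : B) : jointOutput T ρ (r, b) (r', b') =
      T (Matrix.of fun a a' => CFC.sqrt ρ r a * CFC.sqrt ρ a' r') b b' := by
  simp [jointOutput, idTensor, purification_apply]

/-- Conjugation of an operator on `A' ⊗ B` by `√ρ ⊗ I`; it takes the Choi matrix of a channel to
its joint reference-output operator for `ρ`. -/
def sandwich (ρ : Matrix A A ℂ) (J : Matrix (A × B) (A × B) ℂ) : Matrix (A × B) (A × B) ℂ :=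
  (CFC.sqrt ρ ⊗ₖ (1 : Matrix B B ℂ)) * J * (CFC.sqrt ρ ⊗ₖ (1 : Matrix B B ℂ))

lemma sandwich_apply (ρ : Matrix A A ℂ) (J : Matrix (A × B) (A × B) ℂ) (r r' : A) (b b' : B) :
    sandwich ρ J (r, b) (r', b') =
      ∑ x, ∑ y, CFC.sqrt ρ r x * CFC.sqrt ρ y r' * J (x, b) (y, b') := by
  simp only [sandwich, Matrix.mul_apply, Fintype.sum_prod_type, kroneckerMap_apply,
    Matrix.one_apply, mul_ite, mul_one, mul_zero, ite_mul, zero_mul, Finset.sum_ite_eq,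
    Finset.sum_ite_eq', Finset.mem_univ, if_true, Finset.sum_mul]
  rw [Finset.sum_comm]
  exact Finset.sum_congr rfl fun x _ => Finset.sum_congr rfl fun y _ => by ring

/-- The joint output for `ρ` in terms of the Choi matrix, which is the joint output for `1`. -/
lemma jointOutput_eq_sandwich (T : Matrix A A ℂ →ₗ[ℂ] Matrix B B ℂ) (ρ : Matrix A A ℂ) :
    jointOutput T ρ = sandwich ρ (jointOutput T 1) := by
  ext ⟨r, b⟩ ⟨r', b'⟩
  rw [sandwich_apply, jointOutput_apply]
  have : (Matrix.of fun a a' => CFC.sqrt ρ r a * CFC.sqrt ρ a' r') =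
      ∑ x, ∑ y, (CFC.sqrt ρ r x * CFC.sqrt ρ y r') •
        (Matrix.of fun a a' => CFC.sqrt (1 : Matrix A A ℂ) x a * CFC.sqrt (1 : Matrix A A ℂ) a' y)
      := by
    ext a a'
    simp [Matrix.sum_apply, CFC.sqrt_one, Matrix.one_apply]
  rw [this]
  simp only [map_sum, map_smul, Matrix.sum_apply, Matrix.smul_apply, smul_eq_mul,
    jointOutput_apply]

lemma sandwich_posSemidef (ρ : Matrix A A ℂ) {J : Matrix (A × B) (A × B) ℂ}
    (hJ : J.PosSemidef) : (sandwich ρ J).PosSemidef := by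
  have := hJ.mul_mul_conjTranspose_same (CFC.sqrt ρ ⊗ₖ (1 : Matrix B B ℂ))
  rwa [conjTranspose_kronecker, sqrt_conjTranspose, conjTranspose_one] at this

lemma purification_posSemidef (ρ : Matrix A A ℂ) : (purification ρ).PosSemidef :=
  sandwich_posSemidef ρ (posSemidef_vecMulVec_self_star (maxEnt A))

lemma IsChannel.posSemidef_idTensor {R : Type*} [Fintype R]
    {T : Matrix A A ℂ →ₗ[ℂ] Matrix B B ℂ} (hT : IsChannel T) {X : Matrix (R × A) (R × A) ℂ}
    (hX : X.PosSemidef) : (idTensor R T X).PosSemidef := by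
  have e := Fintype.equivFin R
  have h := hT.completelyPositive _ _ (hX.submatrix (e.symm.prodCongr (Equiv.refl A)))
  have h2 := h.submatrix (e.prodCongr (Equiv.refl B))
  convert h2 using 1
  ext ⟨r, b⟩ ⟨r', b'⟩
  simp [idTensor]

lemma IsChannel.jointOutput_posSemidef {T : Matrix A A ℂ →ₗ[ℂ] Matrix B B ℂ} (hT : IsChannel T)
    (ρ : Matrix A A ℂ) : (jointOutput T ρ).PosSemidef :=
  hT.posSemidef_idTensor (purification_posSemidef ρ)

lemma IsChannel.trRight_jointOutput {T : Matrix A A ℂ →ₗ[ℂ] Matrix B B ℂ} (hT : IsChannel T)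
    {ρ : Matrix A A ℂ} (hρ : ρ.PosSemidef) : trRight (jointOutput T ρ) = ρ := by
  ext i i'
  have h1 : trRight (jointOutput T ρ) i i' =
      (T (Matrix.of fun a a' => CFC.sqrt ρ i a * CFC.sqrt ρ a' i')).trace := by
    simp [trRight, jointOutput_apply, Matrix.trace]
  conv_rhs => rw [← sqrt_mul_sqrt hρ]
  rw [h1, hT.tracePreserving]
  simp [Matrix.trace, Matrix.mul_apply]

lemma trace_trRight (X : Matrix (A × B) (A × B) ℂ) : (trRight X).trace = X.trace := by
  simp [trRight, Matrix.trace, Fintype.sum_prod_type]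

lemma IsChannel.jointOutput_mem_density {T : Matrix A A ℂ →ₗ[ℂ] Matrix B B ℂ} (hT : IsChannel T)
    {ρ : Matrix A A ℂ} (hρ : ρ ∈ density A) : jointOutput T ρ ∈ density (A × B) :=
  ⟨hT.jointOutput_posSemidef ρ, by rw [← trace_trRight, hT.trRight_jointOutput hρ.1, hρ.2]⟩

/-- The root fidelity of the joint outputs for the input `ρ`, in terms of Choi matrices. -/
def choiFidelity (ρ : Matrix A A ℂ) (J J' : Matrix (A × B) (A × B) ℂ) : ℝ :=
  rootFidelity (sandwich ρ J) (sandwich ρ J')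

lemma continuousOn_choiFidelity_left {J J' : Matrix (A × B) (A × B) ℂ} (hJ : J.PosSemidef)
    (hJ' : J'.PosSemidef) :
    ContinuousOn (fun ρ => choiFidelity ρ J J') {ρ : Matrix A A ℂ | ρ.PosSemidef} := by
  have h : ∀ J : Matrix (A × B) (A × B) ℂ,
      ContinuousOn (fun ρ => sandwich ρ J) {ρ : Matrix A A ℂ | ρ.PosSemidef} := by
    intro J
    have : Continuous fun s : Matrix A A ℂ =>
        (s ⊗ₖ (1 : Matrix B B ℂ)) * J * (s ⊗ₖ (1 : Matrix B B ℂ)) := by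
      have h1 : Continuous fun s : Matrix A A ℂ => s ⊗ₖ (1 : Matrix B B ℂ) :=
        continuous_matrix fun p q =>
          (continuous_id.matrix_elem p.1 q.1).mul continuous_const
      exact (h1.mul continuous_const).mul h1
    exact this.comp_continuousOn continuousOn_matrix_sqrt
  exact continuousOn_rootFidelity (h J) (h J') (fun ρ _ => sandwich_posSemidef ρ hJ)
    (fun ρ _ => sandwich_posSemidef ρ hJ')

lemma continuousOn_choiFidelity_right (ρ : Matrix A A ℂ) {J : Matrix (A × B) (A × B) ℂ}
    (hJ : J.PosSemidef) : ContinuousOn (fun J' => choiFidelity ρ J J') {J' | J'.PosSemidef} := by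
  refine continuousOn_rootFidelity continuousOn_const ?_ (fun ρ _ => sandwich_posSemidef _ hJ)
    (fun J' hJ' => sandwich_posSemidef _ hJ')
  exact ((continuous_const.mul continuous_id).mul continuous_const).continuousOn

lemma convex_density {n : Type*} [Fintype n] : Convex ℝ (density n) := by
  intro x hx y hy a b ha hb hab
  refine ⟨(hx.1.smul ha).add (hy.1.smul hb), ?_⟩
  rw [trace_add, trace_smul, trace_smul, hx.2, hy.2, ← add_smul, hab, one_smul]

/-- For a fixed pair of channels the root fidelity of the joint outputs is convex in the input. -/
lemma convexOn_choiFidelity {J J' : Matrix (A × B) (A × B) ℂ} (hJ : J.PosSemidef)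
    (hJ' : J'.PosSemidef) : ConvexOn ℝ (density A) fun ρ => choiFidelity ρ J J' := by
  have purif : ∀ {J : Matrix (A × B) (A × B) ℂ}, J.PosSemidef → ∀ ρ : Matrix A A ℂ,
      ((CFC.sqrt ρ ⊗ₖ (1 : Matrix B B ℂ)) * CFC.sqrt J) *
        ((CFC.sqrt ρ ⊗ₖ (1 : Matrix B B ℂ)) * CFC.sqrt J)ᴴ = sandwich ρ J := by
    intro J hJ ρ
    rw [conjTranspose_mul, conjTranspose_kronecker, sqrt_conjTranspose, sqrt_conjTranspose,
      conjTranspose_one, sandwich]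
    conv_rhs => rw [← sqrt_mul_sqrt hJ]
    simp only [Matrix.mul_assoc]
  have cross : ∀ {ρ : Matrix A A ℂ}, ρ.PosSemidef →
      ((CFC.sqrt ρ ⊗ₖ (1 : Matrix B B ℂ)) * CFC.sqrt J)ᴴ *
        ((CFC.sqrt ρ ⊗ₖ (1 : Matrix B B ℂ)) * CFC.sqrt J') =
      CFC.sqrt J * (ρ ⊗ₖ (1 : Matrix B B ℂ)) * CFC.sqrt J' := by
    intro ρ hρ
    rw [conjTranspose_mul, conjTranspose_kronecker, sqrt_conjTranspose, sqrt_conjTranspose,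
      conjTranspose_one]
    calc _ = CFC.sqrt J * ((CFC.sqrt ρ ⊗ₖ (1 : Matrix B B ℂ)) *
          (CFC.sqrt ρ ⊗ₖ (1 : Matrix B B ℂ))) * CFC.sqrt J' := by simp only [Matrix.mul_assoc]
      _ = _ := by rw [← mul_kronecker_mul, sqrt_mul_sqrt hρ, Matrix.mul_one]
  -- the root fidelity is a maximum of functions which are linear in `ρ`
  have le : ∀ {ρ : Matrix A A ℂ}, ρ.PosSemidef → ∀ U : Matrix (A × B) (A × B) ℂ,
      Uᴴ * U = 1 → U * Uᴴ = 1 →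
      (U * (CFC.sqrt J * (ρ ⊗ₖ (1 : Matrix B B ℂ)) * CFC.sqrt J')).trace.re ≤
        choiFidelity ρ J J' := by
    intro ρ hρ U hU hU'
    have h := re_trace_le_rootFidelity ((CFC.sqrt ρ ⊗ₖ (1 : Matrix B B ℂ)) * CFC.sqrt J')
      ((CFC.sqrt ρ ⊗ₖ (1 : Matrix B B ℂ)) * CFC.sqrt J * Uᴴ)
    have e : ∀ X : Matrix (A × B) (A × B) ℂ, (X * Uᴴ) * (X * Uᴴ)ᴴ = X * Xᴴ := by
      intro X
      rw [conjTranspose_mul, conjTranspose_conjTranspose]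
      calc _ = X * (Uᴴ * U) * Xᴴ := by simp only [Matrix.mul_assoc]
        _ = _ := by rw [hU, Matrix.mul_one]
    rw [e, purif hJ, purif hJ',
      rootFidelity_comm (sandwich_posSemidef _ hJ') (sandwich_posSemidef _ hJ),
      conjTranspose_mul _ Uᴴ, conjTranspose_conjTranspose, trace_mul_comm, Matrix.mul_assoc,
      cross hρ] at h
    exact h
  refine ⟨convex_density, fun x hx y hy a b ha hb hab => ?_⟩
  have hz := convex_density hx hy ha hb hab
  obtain ⟨U, hU, hU', h⟩ := exists_unitary_rootFidelity_eq
    ((CFC.sqrt (a • x + b • y) ⊗ₖ (1 : Matrix B B ℂ)) * CFC.sqrt J)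
    ((CFC.sqrt (a • x + b • y) ⊗ₖ (1 : Matrix B B ℂ)) * CFC.sqrt J')
  rw [purif hJ, purif hJ', cross hz.1] at h
  have e : (U * (CFC.sqrt J * ((a • x + b • y) ⊗ₖ (1 : Matrix B B ℂ)) * CFC.sqrt J')).trace.re =
      a * (U * (CFC.sqrt J * (x ⊗ₖ (1 : Matrix B B ℂ)) * CFC.sqrt J')).trace.re +
      b * (U * (CFC.sqrt J * (y ⊗ₖ (1 : Matrix B B ℂ)) * CFC.sqrt J')).trace.re := by
    rw [add_kronecker, smul_kronecker, smul_kronecker]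
    simp only [Matrix.mul_add, Matrix.add_mul, Matrix.smul_mul, Matrix.mul_smul, trace_add,
      trace_smul, Complex.add_re, Complex.real_smul, Complex.re_ofReal_mul]
  change choiFidelity _ J J' ≤ _
  rw [choiFidelity, ← h, e]
  exact add_le_add (mul_le_mul_of_nonneg_left (le hx.1 U hU hU') ha)
    (mul_le_mul_of_nonneg_left (le hy.1 U hU hU') hb)

/-- Joint concavity of the root fidelity, for nonnegative weights that need not add up to one. -/
lemma rootFidelity_combo {n : Type*} [Fintype n] [DecidableEq n] {P P' Q Q' : Matrix n n ℂ}
    (hP : P.PosSemidef) (hP' : P'.PosSemidef) (hQ : Q.PosSemidef) (hQ' : Q'.PosSemidef)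
    {a b : ℝ} (ha : 0 ≤ a) (hb : 0 ≤ b) :
    a * rootFidelity P Q + b * rootFidelity P' Q' ≤
      rootFidelity (a • P + b • P') (a • Q + b • Q') := by
  have h := sum_rootFidelity_le (ι := Bool)
    (P := fun i => bif i then (a : ℂ) • P else (b : ℂ) • P')
    (Q := fun i => bif i then (a : ℂ) • Q else (b : ℂ) • Q')
    (by rintro (_ | _)
        · exact hP'.smul (by simpa using hb)
        · exact hP.smul (by simpa using ha))
    (by rintro (_ | _)
        · exact hQ'.smul (by simpa using hb)
        · exact hQ.smul (by simpa using ha))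
  simp only [Fintype.sum_bool, cond_true, cond_false, rootFidelity_smul hP hQ ha ha,
    rootFidelity_smul hP' hQ' hb hb, Real.mul_self_sqrt ha, Real.mul_self_sqrt hb] at h
  exact h

lemma concaveOn_choiFidelity (ρ : Matrix A A ℂ) {J : Matrix (A × B) (A × B) ℂ}
    (hJ : J.PosSemidef) {s : Set (Matrix (A × B) (A × B) ℂ)} (hs : Convex ℝ s)
    (hs0 : ∀ J' ∈ s, J'.PosSemidef) : ConcaveOn ℝ s fun J' => choiFidelity ρ J J' := by
  refine ⟨hs, fun x hx y hy a b ha hb hab => ?_⟩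
  have h := rootFidelity_combo (sandwich_posSemidef ρ hJ) (sandwich_posSemidef ρ hJ)
    (sandwich_posSemidef ρ (hs0 x hx)) (sandwich_posSemidef ρ (hs0 y hy)) ha hb
  rw [← add_smul, hab, one_smul] at h
  have e : sandwich ρ (a • x + b • y) = a • sandwich ρ x + b • sandwich ρ y := by
    simp [sandwich, Matrix.mul_add, Matrix.add_mul]
  simp only [choiFidelity, e, smul_eq_mul]
  exact h

end Choi

/-! ### Tensor powers -/

section TensorPower

variable {ι B : Type*} [Fintype ι] [Fintype B]

/-- The tensor power `σ^{⊗ι}`, as an operator on the functions `ι → B`. -/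
def tensorPow (ι : Type*) [Fintype ι] {B : Type*} (σ : Matrix B B ℂ) :
    Matrix (ι → B) (ι → B) ℂ :=
  Matrix.of fun f g => ∏ i, σ (f i) (g i)

lemma tensorPow_mul (σ τ : Matrix B B ℂ) [DecidableEq ι] :
    tensorPow ι σ * tensorPow ι τ = tensorPow ι (σ * τ) := by
  ext f g
  simp [tensorPow, Matrix.mul_apply, Finset.prod_univ_sum, Finset.prod_mul_distrib]

lemma tensorPow_conjTranspose (σ : Matrix B B ℂ) : (tensorPow ι σ)ᴴ = tensorPow ι σᴴ := by
  ext f g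
  simp [tensorPow]

lemma tensorPow_one [DecidableEq B] : tensorPow ι (1 : Matrix B B ℂ) = 1 := by
  ext f g
  simp [tensorPow, Matrix.one_apply, Finset.prod_ite_zero, funext_iff]

lemma trace_tensorPow [DecidableEq ι] (σ : Matrix B B ℂ) :
    (tensorPow ι σ).trace = σ.trace ^ Fintype.card ι := by
  have := Finset.prod_univ_sum (fun _ : ι => (Finset.univ : Finset B)) (fun _ b => σ b b)
  simp only [Finset.prod_const, Finset.card_univ, Fintype.piFinset_univ] at this
  simp [Matrix.trace, tensorPow, this]

lemma tensorPow_posSemidef [DecidableEq ι] [DecidableEq B] {σ : Matrix B B ℂ}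
    (hσ : σ.PosSemidef) : (tensorPow ι σ).PosSemidef := by
  rw [← sqrt_mul_sqrt hσ]
  nth_rewrite 1 [← sqrt_conjTranspose]
  rw [← tensorPow_mul, ← tensorPow_conjTranspose]
  exact posSemidef_conjTranspose_mul_self _

lemma tensorPow_posDef [DecidableEq ι] [DecidableEq B] {σ : Matrix B B ℂ} (hσ : σ.PosDef) :
    (tensorPow ι σ).PosDef := by
  refine (tensorPow_posSemidef hσ.posSemidef).posDef_iff_isUnit.2 ?_
  refine IsUnit.of_mul_eq_one (tensorPow ι σ⁻¹) ?_
  rw [tensorPow_mul, mul_nonsing_inv _ ((isUnit_iff_isUnit_det σ).1 hσ.isUnit), tensorPow_one]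

end TensorPower

/-! ### Operators on `A` and a family of copies of `B` -/

section Slots

variable {ι A B : Type*} [Fintype ι] [DecidableEq ι] [Fintype A] [DecidableEq A] [Fintype B]
  [DecidableEq B]

/-- Separates the `m`-th copy of `B` from the other ones. -/
def slotEquiv (A B : Type*) (m : ι) : A × (ι → B) ≃ (A × B) × ({j // j ≠ m} → B) :=
  ((Equiv.refl A).prodCongr (Equiv.funSplitAt m B)).trans (Equiv.prodAssoc A B _).symm

/-- The marginal on `A` and the `m`-th copy of `B`. -/
def margin (m : ι) (X : Matrix (A × (ι → B)) (A × (ι → B)) ℂ) : Matrix (A × B) (A × B) ℂ :=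
  trRight (X.submatrix (slotEquiv A B m).symm (slotEquiv A B m).symm)

/-- The state `τ` on `A` and the `m`-th copy of `B`, and `σ` on each of the other copies. -/
def slotState (τ : Matrix (A × B) (A × B) ℂ) (σ : Matrix B B ℂ) (m : ι) :
    Matrix (A × (ι → B)) (A × (ι → B)) ℂ :=
  (τ ⊗ₖ tensorPow {j // j ≠ m} σ).submatrix (slotEquiv A B m) (slotEquiv A B m)

/-- The operator `G` on `A` and the `m`-th copy of `B`, and the identity on the other copies. -/
def slotLift (m : ι) (G : Matrix (A × B) (A × B) ℂ) : Matrix (A × (ι → B)) (A × (ι → B)) ℂ :=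
  (G ⊗ₖ (1 : Matrix ({j // j ≠ m} → B) ({j // j ≠ m} → B) ℂ)).submatrix
    (slotEquiv A B m) (slotEquiv A B m)

lemma slotState_apply (τ : Matrix (A × B) (A × B) ℂ) (σ : Matrix B B ℂ) (m : ι) (a a' : A)
    (f f' : ι → B) : slotState τ σ m (a, f) (a', f') =
      ∏ i, if i = m then τ (a, f i) (a', f' i) else σ (f i) (f' i) := by
  rw [Fintype.prod_eq_mul_prod_subtype_ne _ m]
  simp only [slotState, slotEquiv, submatrix_apply, kroneckerMap_apply, tensorPow, if_true]
  congr 1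
  exact Finset.prod_congr rfl fun j _ => by simp [j.2]

lemma slotState_kronecker (ρ : Matrix A A ℂ) (σ : Matrix B B ℂ) (m : ι) :
    slotState (ρ ⊗ₖ σ) σ m = ρ ⊗ₖ tensorPow ι σ := by
  ext ⟨a, f⟩ ⟨a', f'⟩
  simp only [kroneckerMap_apply, tensorPow, of_apply]
  rw [Fintype.prod_eq_mul_prod_subtype_ne _ m]
  simp [slotState, slotEquiv, kroneckerMap_apply, tensorPow, mul_assoc]

lemma slotLift_mul_slotState (G R : Matrix (A × B) (A × B) ℂ) (σ : Matrix B B ℂ) (m : ι) :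
    slotLift m G * slotState R σ m = slotState (G * R) σ m := by
  rw [slotLift, slotState, submatrix_mul_equiv, ← mul_kronecker_mul, Matrix.one_mul]
  rfl

lemma trace_submatrix_equiv {m n : Type*} [Fintype m] [Fintype n] (e : m ≃ n)
    (X : Matrix n n ℂ) : (X.submatrix e e).trace = X.trace :=
  e.sum_comp fun i => X i i

lemma trace_margin (m : ι) (X : Matrix (A × (ι → B)) (A × (ι → B)) ℂ) :
    (margin m X).trace = X.trace := by
  rw [margin, trace_trRight, trace_submatrix_equiv]

/-- `slotLift m` is the adjoint of `margin m`. -/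
lemma trace_slotLift_mul (m : ι) (G : Matrix (A × B) (A × B) ℂ)
    (X : Matrix (A × (ι → B)) (A × (ι → B)) ℂ) :
    (slotLift m G * X).trace = (G * margin m X).trace := by
  have h : slotLift m G * X = ((G ⊗ₖ (1 : Matrix ({j // j ≠ m} → B) ({j // j ≠ m} → B) ℂ)) *
      X.submatrix (slotEquiv A B m).symm (slotEquiv A B m).symm).submatrix
        (slotEquiv A B m) (slotEquiv A B m) := by
    rw [← submatrix_mul_equiv _ _ _ (slotEquiv A B m)]
    simp [slotLift]
  rw [h, trace_submatrix_equiv, margin]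
  generalize X.submatrix (slotEquiv A B m).symm (slotEquiv A B m).symm = Y
  simp only [Matrix.trace, diag_apply, Matrix.mul_apply]
  rw [Fintype.sum_prod_type]
  refine Finset.sum_congr rfl fun p _ => ?_
  simp only [Fintype.sum_prod_type (γ := ℂ), kroneckerMap_apply, Matrix.one_apply, mul_ite, mul_one,
    mul_zero, ite_mul, zero_mul, Finset.sum_ite_eq, Finset.mem_univ, if_true, trRight, of_apply,
    Finset.mul_sum]
  rw [Finset.sum_comm]
  refine Finset.sum_congr rfl fun a _ => ?_
  rw [Finset.sum_comm]

lemma margin_slotState_self (τ : Matrix (A × B) (A × B) ℂ) {σ : Matrix B B ℂ}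
    (hσ : σ.trace = 1) (m : ι) : margin m (slotState τ σ m) = τ := by
  ext p q
  have h := trace_tensorPow (ι := {j // j ≠ m}) σ
  rw [hσ, one_pow] at h
  simp only [Matrix.trace, diag_apply] at h
  simp [margin, slotState, trRight, kroneckerMap_apply, ← Finset.mul_sum, h]

/-- On `A` and a slot other than that of `τ`, the state is the product of the marginal of `τ` with `σ`.
-/
lemma margin_slotState_ne (τ : Matrix (A × B) (A × B) ℂ) {σ : Matrix B B ℂ}
    (hσ : σ.trace = 1) {m m' : ι} (h : m ≠ m') :
    margin m (slotState τ σ m') = trRight τ ⊗ₖ σ := by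
  ext ⟨a, b⟩ ⟨a', b'⟩
  have h1 : ∀ g : {j // j ≠ m} → B,
      (slotState τ σ m').submatrix (slotEquiv A B m).symm (slotEquiv A B m).symm
        ((a, b), g) ((a', b'), g) = σ b b' * ∏ j : {j // j ≠ m},
          if (j : ι) = m' then τ (a, g j) (a', g j) else σ (g j) (g j) := by
    intro g
    simp only [submatrix_apply]
    have : ∀ (a : A) (b : B), (slotEquiv A B m).symm ((a, b), g) =
        (a, (Equiv.funSplitAt m B).symm (b, g)) := fun _ _ => rfl
    rw [this, this, slotState_apply, Fintype.prod_eq_mul_prod_subtype_ne _ m]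
    congr 1
    · simp [h]
    · refine Finset.prod_congr rfl fun j _ => ?_
      simp [j.2]
  simp only [margin, trRight, of_apply, h1, kroneckerMap_apply]
  rw [← Finset.mul_sum, mul_comm]
  congr 1
  have h2 := Finset.prod_univ_sum (fun _ : {j // j ≠ m} => (Finset.univ : Finset B))
    (fun j x => if (j : ι) = m' then τ (a, x) (a', x) else σ x x)
  rw [Fintype.piFinset_univ] at h2
  rw [← h2, Fintype.prod_eq_single ⟨m', h.symm⟩]
  · simp
  · intro j hj
    have : (j : ι) ≠ m' := fun e => hj (Subtype.ext e)
    simpa [this, Matrix.trace] using hσ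

lemma slotState_posDef {τ : Matrix (A × B) (A × B) ℂ} {σ : Matrix B B ℂ} (hτ : τ.PosDef)
    (hσ : σ.PosDef) (m : ι) : (slotState τ σ m).PosDef :=
  (hτ.kronecker (tensorPow_posDef hσ)).submatrix (slotEquiv A B m).injective

/-- The rows of a factor `X` regrouped so that `margin m (X Xᴴ)` factors through it. -/
def marginFactor {J : Type*} (m : ι) (X : Matrix (A × (ι → B)) J ℂ) :
    Matrix (A × B) (({j // j ≠ m} → B) × J) ℂ :=
  Matrix.of fun p q => X ((slotEquiv A B m).symm (p, q.1)) q.2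

lemma marginFactor_mul {J : Type*} [Fintype J] (m : ι) (X Y : Matrix (A × (ι → B)) J ℂ) :
    marginFactor m X * (marginFactor m Y)ᴴ = margin m (X * Yᴴ) := by
  ext p q
  simp [marginFactor, margin, trRight, Matrix.mul_apply, Fintype.sum_prod_type]

lemma margin_smul (m : ι) (c : ℂ) (X : Matrix (A × (ι → B)) (A × (ι → B)) ℂ) :
    margin m (c • X) = c • margin m X := by
  ext p q
  simp [margin, trRight, Finset.mul_sum]

end Slots

/-! ### Trace inequalities -/

section TraceInequalities

variable {n : Type*} [Fintype n] [DecidableEq n]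

lemma re_trace_mul_nonneg {P Q : Matrix n n ℂ} (hP : P.PosSemidef) (hQ : Q.PosSemidef) :
    0 ≤ (P * Q).trace.re := by
  have h := re_trace_nonneg (posSemidef_sqrt_sandwich (P := P) hQ)
  rwa [trace_mul_comm, ← Matrix.mul_assoc, sqrt_mul_sqrt hP] at h

lemma isUnit_det {P : Matrix n n ℂ} (hP : P.PosDef) : IsUnit P.det :=
  (isUnit_iff_isUnit_det P).1 hP.isUnit

lemma sqrt_posDef {P : Matrix n n ℂ} (hP : P.PosDef) : (CFC.sqrt P).PosDef := by
  refine (sqrt_posSemidef P).posDef_iff_isUnit.2 ?_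
  exact (CFC.isUnit_sqrt_iff P hP.posSemidef.nonneg).2 hP.isUnit

/-- A trace version of the scalar inequality `√(p q) ≥ (3 p - p² / q) / 2`. -/
lemma re_trace_mul_ge {g r : Matrix n n ℂ} (hg : g.PosSemidef) (hr : r.PosDef) :
    3 * (g * g).trace.re - (g * g * (r * r)⁻¹ * (g * g)).trace.re ≤ 2 * (g * r).trace.re := by
  -- with `p = g²`, `q = r²`, `p² / q - 3 p + 2 √(p q) = (g - r)² g² / r² + 2 (g - r)² g / r`
  have hd : (g - r)ᴴ = g - r := by
    rw [conjTranspose_sub, hg.isHermitian.eq, hr.isHermitian.eq]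
  have rr : r * r⁻¹ = 1 := mul_nonsing_inv _ (isUnit_det hr)
  have hri : (r⁻¹)ᴴ = r⁻¹ := hr.inv.isHermitian
  have p1 : ((g - r) * g * (g - r)).PosSemidef := by
    have := hg.mul_mul_conjTranspose_same (g - r)
    rwa [hd] at this
  have p2 : ((g - r) * (g * g) * (g - r)).PosSemidef := by
    have := (posSemidef_self_mul_conjTranspose g).mul_mul_conjTranspose_same (g - r)
    rwa [hd, hg.isHermitian.eq] at this
  have p3 : (r⁻¹ * r⁻¹).PosSemidef := by
    have := posSemidef_self_mul_conjTranspose r⁻¹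
    rwa [hri] at this
  have h1 := re_trace_mul_nonneg p1 hr.inv.posSemidef
  have h2 := re_trace_mul_nonneg p2 p3
  have e1 : (g - r) * g * (g - r) * r⁻¹ =
      g * g * g * r⁻¹ - g * g - r * g * g * r⁻¹ + r * g := by
    have : (g - r) * g * (g - r) * r⁻¹ =
        g * g * g * r⁻¹ - g * g * (r * r⁻¹) - r * g * g * r⁻¹ + r * g * (r * r⁻¹) := by noncomm_ring
    rw [this, rr, Matrix.mul_one, Matrix.mul_one]
  have e2 : (g - r) * (g * g) * (g - r) * (r⁻¹ * r⁻¹) =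
      g * g * g * g * r⁻¹ * r⁻¹ - g * g * g * r⁻¹ - r * (g * g * g * r⁻¹ * r⁻¹)
        + r * (g * g * r⁻¹) := by
    have : (g - r) * (g * g) * (g - r) * (r⁻¹ * r⁻¹) =
        g * g * g * g * r⁻¹ * r⁻¹ - g * g * g * (r * r⁻¹) * r⁻¹ - r * (g * g * g * r⁻¹ * r⁻¹)
        + r * (g * g * (r * r⁻¹) * r⁻¹) := by noncomm_ring
    rw [this, rr, Matrix.mul_one, Matrix.mul_one]
  have cyc : ∀ X : Matrix n n ℂ, (r * (X * r⁻¹)).trace = X.trace := by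
    intro X
    rw [trace_mul_comm, Matrix.mul_assoc, nonsing_inv_mul _ (isUnit_det hr), Matrix.mul_one]
  have t1 : (r * g * g * r⁻¹).trace = (g * g).trace := by
    rw [← cyc (g * g)]; simp only [Matrix.mul_assoc]
  have t2 : (r * g).trace = (g * r).trace := trace_mul_comm _ _
  have t3 : (g * g * (r * r)⁻¹ * (g * g)).trace = (g * g * g * g * r⁻¹ * r⁻¹).trace := by
    rw [trace_mul_comm, Matrix.mul_inv_rev]; simp only [Matrix.mul_assoc]
  rw [e1, trace_add, trace_sub, trace_sub, t1, t2] at h1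
  rw [e2, trace_add, trace_sub, trace_sub, cyc, cyc] at h2
  rw [t3]
  simp only [Complex.add_re, Complex.sub_re] at h1 h2
  linarith

/-- If `τ ≤ k R` then `tr (τ R⁻¹ τ) ≤ k tr τ`. -/
lemma re_trace_mul_inv_mul_le {τ R : Matrix n n ℂ} (hτ : τ.PosSemidef) (hR : R.PosDef) {k : ℝ}
    (hk : 0 < k) (h : ((k : ℂ) • R - τ).PosSemidef) :
    (τ * R⁻¹ * τ).trace.re ≤ k * τ.trace.re := by
  set c : ℂ := ((k⁻¹ : ℝ) : ℂ) with hc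
  have hck : c * (k : ℂ) = 1 := by
    rw [hc, ← Complex.ofReal_mul, inv_mul_cancel₀ hk.ne', Complex.ofReal_one]
  have hcs : star c = c := by simp [hc]
  -- `τ - τ (k R)⁻¹ τ = (L - 1)ᴴ τ (L - 1) + Lᴴ (k R - τ) L` for `L = (k R)⁻¹ τ`
  set L : Matrix n n ℂ := c • (R⁻¹ * τ) with hL
  have hLH : Lᴴ = c • (τ * R⁻¹) := by
    rw [hL, conjTranspose_smul, conjTranspose_mul, hτ.isHermitian.eq, hR.inv.isHermitian.eq, hcs]
  have rr : R⁻¹ * R = 1 := nonsing_inv_mul _ (isUnit_det hR)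
  have p1 := re_trace_nonneg (h.conjTranspose_mul_mul_same L)
  have p2 := re_trace_nonneg (hτ.conjTranspose_mul_mul_same (L - 1))
  have e0 : Lᴴ * ((k : ℂ) • R) * L = c • (τ * R⁻¹ * τ) := by
    rw [hLH, hL]
    simp only [Matrix.smul_mul, Matrix.mul_smul, smul_smul]
    rw [mul_comm (k : ℂ) c, hck, mul_one, Matrix.mul_assoc τ, rr, Matrix.mul_one, ← Matrix.mul_assoc]
  have e1 : Lᴴ * ((k : ℂ) • R - τ) * L = c • (τ * R⁻¹ * τ) - Lᴴ * τ * L := by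
    rw [Matrix.mul_sub, Matrix.sub_mul, e0]
  have e2 : (L - 1)ᴴ * τ * (L - 1) = Lᴴ * τ * L - c • (τ * R⁻¹ * τ) - c • (τ * R⁻¹ * τ) + τ := by
    have a1 : Lᴴ * τ = c • (τ * R⁻¹ * τ) := by rw [hLH, Matrix.smul_mul]
    have a2 : τ * L = c • (τ * R⁻¹ * τ) := by rw [hL, Matrix.mul_smul, Matrix.mul_assoc]
    rw [conjTranspose_sub, conjTranspose_one, ← a1]
    nth_rewrite 2 [a1]
    rw [← a2]
    noncomm_ring
  rw [e1, trace_sub, Complex.sub_re] at p1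
  rw [e2, trace_add, trace_sub, trace_sub, Complex.add_re, Complex.sub_re, Complex.sub_re] at p2
  have e3 : (c • (τ * R⁻¹ * τ)).trace.re = k⁻¹ * (τ * R⁻¹ * τ).trace.re := by
    rw [trace_smul, smul_eq_mul, hc, Complex.re_ofReal_mul]
  rw [e3] at p1 p2
  have : k⁻¹ * (τ * R⁻¹ * τ).trace.re ≤ τ.trace.re := by linarith
  rwa [inv_mul_le_iff₀ hk] at this

end TraceInequalities

/-! ### The convex-split mixture -/

section ConvexSplit

variable {ι A B : Type*} [Fintype ι] [DecidableEq ι] [Fintype A] [DecidableEq A] [Fintype B]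
  [DecidableEq B]

/-- The cross terms of the collision divergence: `slotState τ σ m` times the inverse of `ρ ⊗ σ^{⊗ι}`
acts on slot `m` only, which reduces the trace to the marginal of the other factor on that slot. -/
lemma trace_slotState_mul_inv_mul {ρ : Matrix A A ℂ} {σ : Matrix B B ℂ}
    {τ : Matrix (A × B) (A × B) ℂ} (hρ : ρ.PosDef) (hσ : σ.PosDef) (hσ1 : σ.trace = 1)
    (hτρ : trRight τ = ρ) (m m' : ι) :
    (slotState τ σ m * (ρ ⊗ₖ tensorPow ι σ)⁻¹ * slotState τ σ m').trace =
      if m = m' then (τ * (ρ ⊗ₖ σ)⁻¹ * τ).trace else τ.trace := by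
  have hR : (ρ ⊗ₖ σ).PosDef := hρ.kronecker hσ
  have hS : (ρ ⊗ₖ tensorPow ι σ).PosDef := hρ.kronecker (tensorPow_posDef hσ)
  have h1 : slotState τ σ m = slotLift m (τ * (ρ ⊗ₖ σ)⁻¹) * (ρ ⊗ₖ tensorPow ι σ) := by
    rw [← slotState_kronecker ρ σ m, slotLift_mul_slotState, Matrix.mul_assoc,
      nonsing_inv_mul _ (isUnit_det hR), Matrix.mul_one]
  rw [h1, Matrix.mul_assoc _ _ (_⁻¹), mul_nonsing_inv _ (isUnit_det hS), Matrix.mul_one,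
    trace_slotLift_mul]
  split_ifs with h
  · subst h
    rw [margin_slotState_self _ hσ1]
  · rw [margin_slotState_ne _ hσ1 h, hτρ, Matrix.mul_assoc, nonsing_inv_mul _ (isUnit_det hR),
      Matrix.mul_one]

/-- The convex-split mixture: the average over the slots `m` of the states which are `τ` in slot
`m` and `σ` elsewhere. -/
def convexSplit (ι : Type*) [Fintype ι] [DecidableEq ι] (τ : Matrix (A × B) (A × B) ℂ)
    (σ : Matrix B B ℂ) : Matrix (A × (ι → B)) (A × (ι → B)) ℂ :=
  ∑ m : ι, (((Fintype.card ι : ℝ)⁻¹ : ℝ) : ℂ) • slotState τ σ m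

/-- The convex-split lemma, in terms of the (non-sandwiched) collision divergence. Fixing the marginal
of `τ` on `A` makes the cross terms equal to one. -/
lemma re_trace_convexSplit_le [Nonempty ι] {ρ : Matrix A A ℂ} {σ : Matrix B B ℂ}
    {τ : Matrix (A × B) (A × B) ℂ} (hρ : ρ.PosDef) (hσ : σ.PosDef) (hσ1 : σ.trace = 1)
    (hτ : τ.PosSemidef) (hτ1 : τ.trace = 1) (hτρ : trRight τ = ρ) {k : ℝ} (hk : 0 < k)
    (h : ((k : ℂ) • (ρ ⊗ₖ σ) - τ).PosSemidef) :
    (convexSplit ι τ σ * (ρ ⊗ₖ tensorPow ι σ)⁻¹ * convexSplit ι τ σ).trace.re ≤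
      1 + k / Fintype.card ι := by
  set M : ℝ := (Fintype.card ι : ℝ) with hM
  have hM0 : 0 < M := by rw [hM]; exact_mod_cast Fintype.card_pos
  have hq := re_trace_mul_inv_mul_le hτ (hρ.kronecker hσ) hk h
  rw [hτ1, Complex.one_re, mul_one] at hq
  set q := (τ * (ρ ⊗ₖ σ)⁻¹ * τ).trace with hq'
  have e : (convexSplit ι τ σ * (ρ ⊗ₖ tensorPow ι σ)⁻¹ * convexSplit ι τ σ).trace =
      ∑ m : ι, ∑ m' : ι, ((M⁻¹ : ℝ) : ℂ) * (((M⁻¹ : ℝ) : ℂ) * if m = m' then q else 1) := by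
    rw [convexSplit, Finset.sum_mul, Finset.sum_mul, trace_sum]
    refine Finset.sum_congr rfl fun m _ => ?_
    rw [Finset.mul_sum, trace_sum]
    refine Finset.sum_congr rfl fun m' _ => ?_
    rw [Matrix.smul_mul, Matrix.smul_mul, Matrix.mul_smul, trace_smul, trace_smul,
      trace_slotState_mul_inv_mul hρ hσ hσ1 hτρ, hτ1]
    rfl
  have e2 : ∀ m m' : ι, (((M⁻¹ : ℝ) : ℂ) * (((M⁻¹ : ℝ) : ℂ) * if m = m' then q else 1)).re ≤
      M⁻¹ * (M⁻¹ * (1 + if m = m' then k else 0)) := by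
    intro m m'
    rw [Complex.re_ofReal_mul, Complex.re_ofReal_mul]
    have : (if m = m' then q else 1).re ≤ 1 + if m = m' then k else 0 := by
      split_ifs
      · linarith
      · simp
    gcongr
  rw [e, Complex.re_sum]
  simp only [Complex.re_sum]
  calc _ ≤ ∑ m : ι, ∑ m' : ι, M⁻¹ * (M⁻¹ * (1 + if m = m' then k else 0)) :=
        Finset.sum_le_sum fun m _ => Finset.sum_le_sum fun m' _ => e2 m m'
    _ = 1 + k / M := by
        simp only [← Finset.mul_sum, Finset.sum_add_distrib, Finset.sum_const, Finset.card_univ,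
          Finset.sum_ite_eq, Finset.mem_univ, if_true, nsmul_eq_mul, ← hM]
        field_simp

lemma posDef_real_smul {n : Type*} [Fintype n] {P : Matrix n n ℂ} (hP : P.PosDef) {c : ℝ}
    (hc : 0 < c) : ((c : ℂ) • P).PosDef :=
  hP.smul (by simpa using hc)

lemma convexSplit_posDef [Nonempty ι] {τ : Matrix (A × B) (A × B) ℂ} {σ : Matrix B B ℂ}
    (hτ : τ.PosDef) (hσ : σ.PosDef) : (convexSplit ι τ σ).PosDef := by
  refine posDef_sum Finset.univ_nonempty fun m _ => posDef_real_smul (slotState_posDef hτ hσ m) ?_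
  have : (0 : ℝ) < Fintype.card ι := by exact_mod_cast Fintype.card_pos
  positivity

/-- If `τ ≤ k (ρ ⊗ σ)`, there is a measurement `E` such that measuring the square-root purification
of `ρ ⊗ σ^{⊗ι}` and keeping the slot given by the outcome produces a state close to `τ`. -/
theorem exists_measurement [Nonempty ι] {ρ : Matrix A A ℂ} {σ : Matrix B B ℂ}
    {τ : Matrix (A × B) (A × B) ℂ} (hρ : ρ.PosDef) (hσ : σ.PosDef) (hσ1 : σ.trace = 1)
    (hτ : τ.PosDef) (hτ1 : τ.trace = 1) (hτρ : trRight τ = ρ) {k : ℝ} (hk : 0 < k)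
    (h : ((k : ℂ) • (ρ ⊗ₖ σ) - τ).PosSemidef) :
    ∃ E : ι → Matrix (A × (ι → B)) (A × (ι → B)) ℂ, (∀ m, (E m).PosSemidef) ∧ ∑ m, E m = 1 ∧
      1 - k / (2 * Fintype.card ι) ≤ rootFidelity τ (∑ m, margin m
        ((CFC.sqrt ρ ⊗ₖ CFC.sqrt (tensorPow ι σ)) * E m *
          (CFC.sqrt ρ ⊗ₖ CFC.sqrt (tensorPow ι σ)))) := by
  set M : ℝ := (Fintype.card ι : ℝ) with hM
  have hM0 : 0 < M := by rw [hM]; exact_mod_cast Fintype.card_pos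
  set Γ := convexSplit ι τ σ with hΓ
  have hΓ0 : Γ.PosDef := convexSplit_posDef hτ hσ
  set g := CFC.sqrt Γ with hg
  have hg0 : g.PosDef := sqrt_posDef hΓ0
  have hgg : g * g = Γ := sqrt_mul_sqrt hΓ0.posSemidef
  set r := CFC.sqrt ρ ⊗ₖ CFC.sqrt (tensorPow ι σ) with hr
  have hr0 : r.PosDef := (sqrt_posDef hρ).kronecker (sqrt_posDef (tensorPow_posDef hσ))
  have hrr : r * r = ρ ⊗ₖ tensorPow ι σ := by
    rw [hr, ← mul_kronecker_mul, sqrt_mul_sqrt hρ.posSemidef,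
      sqrt_mul_sqrt (tensorPow_posSemidef hσ.posSemidef)]
  have hgi : (g⁻¹)ᴴ = g⁻¹ := hg0.inv.isHermitian
  have hgg1 : g * g⁻¹ = 1 := mul_nonsing_inv _ (isUnit_det hg0)
  have hgg2 : g⁻¹ * g = 1 := nonsing_inv_mul _ (isUnit_det hg0)
  set s : ι → Matrix (A × (ι → B)) (A × (ι → B)) ℂ :=
    fun m => ((M⁻¹ : ℝ) : ℂ) • slotState τ σ m with hs
  have hs0 : ∀ m, (s m).PosSemidef := fun m =>
    (posDef_real_smul (slotState_posDef hτ hσ m) (inv_pos.2 hM0)).posSemidef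
  have hsum : ∑ m, s m = Γ := rfl
  refine ⟨fun m => g⁻¹ * s m * g⁻¹, fun m => ?_, ?_, ?_⟩
  · have := (hs0 m).mul_mul_conjTranspose_same g⁻¹
    rwa [hgi] at this
  · rw [← Finset.sum_mul, ← Finset.mul_sum, hsum, ← hgg, ← Matrix.mul_assoc, hgg2, Matrix.one_mul,
      hgg1]
  -- the vectors `√(s m)` and `r g⁻¹ √(s m)` purify the two states outcome by outcome
  have hX : ∀ m, CFC.sqrt (s m) * (CFC.sqrt (s m))ᴴ = s m := fun m => by
    rw [sqrt_conjTranspose, sqrt_mul_sqrt (hs0 m)]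
  have hY : ∀ m, (r * g⁻¹ * CFC.sqrt (s m)) * (r * g⁻¹ * CFC.sqrt (s m))ᴴ =
      r * (g⁻¹ * s m * g⁻¹) * r := by
    intro m
    rw [conjTranspose_mul, conjTranspose_mul, hgi, hr0.isHermitian.eq]
    calc _ = r * (g⁻¹ * (CFC.sqrt (s m) * (CFC.sqrt (s m))ᴴ) * g⁻¹) * r := by
          simp only [Matrix.mul_assoc]
      _ = _ := by rw [hX]
  have hXY : ∀ m, CFC.sqrt (s m) * (r * g⁻¹ * CFC.sqrt (s m))ᴴ = s m * (g⁻¹ * r) := by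
    intro m
    rw [conjTranspose_mul, conjTranspose_mul, hgi, hr0.isHermitian.eq, ← Matrix.mul_assoc, hX]
  have key := sum_re_trace_le_rootFidelity
    (fun m => marginFactor m (CFC.sqrt (s m))) (fun m => marginFactor m (r * g⁻¹ * CFC.sqrt (s m)))
  simp only [marginFactor_mul, hX, hY, hXY, trace_margin] at key
  have e1 : ∑ m, margin m (s m) = τ := by
    simp only [hs, margin_smul, margin_slotState_self τ hσ1, Finset.sum_const, Finset.card_univ]
    rw [← Nat.cast_smul_eq_nsmul ℂ, smul_smul]
    have : ((Fintype.card ι : ℕ) : ℂ) * ((M⁻¹ : ℝ) : ℂ) = 1 := by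
      have : ((Fintype.card ι : ℕ) : ℂ) = (M : ℂ) := by simp [hM]
      rw [this, ← Complex.ofReal_mul, mul_inv_cancel₀ hM0.ne', Complex.ofReal_one]
    rw [this, one_smul]
  have e2 : ∑ m, (s m * (g⁻¹ * r)).trace.re = (g * r).trace.re := by
    rw [← Complex.re_sum, ← trace_sum, ← Finset.sum_mul, hsum, ← hgg, Matrix.mul_assoc,
      ← Matrix.mul_assoc g g⁻¹, hgg1, Matrix.one_mul]
  rw [e1, e2] at key
  refine le_trans ?_ key
  have h1 := re_trace_mul_ge hg0.posSemidef hr0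
  have h2 := re_trace_convexSplit_le (ι := ι) hρ hσ hσ1 hτ.posSemidef hτ1 hτρ hk h
  have h3 : Γ.trace.re = 1 := by
    rw [← hsum, trace_sum]
    calc _ = (∑ m, (margin m (s m)).trace).re := by simp only [trace_margin]
      _ = 1 := by rw [← trace_sum, e1, hτ1, Complex.one_re]
  rw [hgg, hrr, h3] at h1
  have h4 : k / (2 * M) = k / M / 2 := by rw [div_div, mul_comm]
  linarith

end ConvexSplit

/-! ### Compact sets of matrices -/

section Compactness

/-- In finite dimension the convex hull of a compact set is compact, by Carathéodory's theorem. -/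
lemma isCompact_convexHull {E : Type*} [AddCommGroup E] [Module ℝ E] [TopologicalSpace E]
    [ContinuousAdd E] [ContinuousSMul ℝ E] [FiniteDimensional ℝ E] {s : Set E}
    (hs : IsCompact s) : IsCompact (convexHull ℝ s) := by
  have h : convexHull ℝ s = ⋃ k ∈ Finset.range (Module.finrank ℝ E + 2),
      (fun p : (Fin k → ℝ) × (Fin k → E) => ∑ i, p.1 i • p.2 i) ''
        (stdSimplex ℝ (Fin k) ×ˢ Set.univ.pi fun _ => s) := by
    apply Set.Subset.antisymm
    · intro x hx
      obtain ⟨ι, _, z, w, hz, hi, hw, hw1, rfl⟩ := eq_pos_convex_span_of_mem_convexHull hx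
      have hc := hi.card_le_finrank_succ
      have hc' : Module.finrank ℝ (vectorSpan ℝ (Set.range z)) ≤ Module.finrank ℝ E :=
        Submodule.finrank_le _
      have e := (Fintype.equivFin ι).symm
      refine Set.mem_biUnion (x := Fintype.card ι) (by simp; omega)
        ⟨(w ∘ e, z ∘ e), ⟨⟨fun i => (hw _).le, ?_⟩, fun i _ => hz ⟨_, rfl⟩⟩, ?_⟩
      · rw [← hw1]; exact e.sum_comp w
      · exact e.sum_comp fun i => w i • z i
    · refine Set.iUnion₂_subset fun k _ => ?_
      rintro _ ⟨⟨w, z⟩, ⟨hw, hz⟩, rfl⟩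
      exact (convex_convexHull ℝ s).sum_mem (fun i _ => hw.1 i) hw.2
        fun i _ => subset_convexHull ℝ s (hz i trivial)
  rw [h]
  refine (Finset.range _).isCompact_biUnion fun k _ => ?_
  refine ((isCompact_stdSimplex ℝ (Fin k)).prod (isCompact_univ_pi fun _ => hs)).image ?_
  fun_prop

variable {n : Type*} [Fintype n]

lemma isClosed_posSemidef : IsClosed {P : Matrix n n ℂ | P.PosSemidef} := by
  have : {P : Matrix n n ℂ | P.PosSemidef} =
      {P | Pᴴ = P} ∩ ⋂ x : n → ℂ, {P | 0 ≤ star x ⬝ᵥ (P *ᵥ x)} := by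
    ext P
    simp only [Set.mem_inter_iff, Set.mem_iInter, Set.mem_ofPred_eq,
      posSemidef_iff_dotProduct_mulVec]
    rfl
  rw [this]
  refine (isClosed_eq continuous_id.matrix_conjTranspose continuous_id).inter
    (isClosed_iInter fun x => ?_)
  exact isClosed_le continuous_const
    (continuous_const.dotProduct (continuous_id.matrix_mulVec continuous_const))

/-- The entries of a positive semidefinite matrix are bounded by its diagonal. -/
lemma norm_entry_le {P : Matrix n n ℂ} (hP : P.PosSemidef) (i j : n) :
    ‖P i j‖ ≤ ((P i i).re + (P j j).re) / 2 := by
  classical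
  obtain ⟨G, hG⟩ : ∃ G : Matrix n n ℂ, P = Gᴴ * G :=
    ⟨CFC.sqrt P, by rw [sqrt_conjTranspose, sqrt_mul_sqrt hP]⟩
  have hd : ∀ i, (P i i).re = ∑ k, ‖G k i‖ ^ 2 := by
    intro i
    rw [hG, Matrix.mul_apply, Complex.re_sum]
    refine Finset.sum_congr rfl fun k _ => ?_
    rw [conjTranspose_apply, Complex.star_def, Complex.conj_mul', ← Complex.ofReal_pow,
      Complex.ofReal_re]
  rw [hd, hd, hG, Matrix.mul_apply, ← Finset.sum_add_distrib, Finset.sum_div]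
  refine (norm_sum_le _ _).trans (Finset.sum_le_sum fun k _ => ?_)
  rw [conjTranspose_apply, norm_mul, norm_star]
  nlinarith [sq_nonneg (‖G k i‖ - ‖G k j‖)]

lemma diag_re_nonneg {P : Matrix n n ℂ} (hP : P.PosSemidef) (i : n) : 0 ≤ (P i i).re :=
  (Complex.nonneg_iff.1 (hP.diag_nonneg (i := i))).1

lemma isCompact_entries_le_one : IsCompact {P : Matrix n n ℂ | ∀ i j, ‖P i j‖ ≤ 1} := by
  have h : IsCompact (Set.univ.pi fun _ : n => Set.univ.pi fun _ : n =>
      Metric.closedBall (0 : ℂ) 1) :=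
    isCompact_univ_pi fun _ => isCompact_univ_pi fun _ => isCompact_closedBall _ _
  have e : {P : Matrix n n ℂ | ∀ i j, ‖P i j‖ ≤ 1} = (Set.univ.pi fun _ : n =>
      Set.univ.pi fun _ : n => Metric.closedBall (0 : ℂ) 1 : Set (n → n → ℂ)) := by
    ext P
    exact ⟨fun h i _ j _ => mem_closedBall_zero_iff.2 (h i j),
      fun h i j => mem_closedBall_zero_iff.1 (h i trivial j trivial)⟩
  rw [e]
  exact h

lemma isCompact_density : IsCompact (density n) := by
  refine isCompact_entries_le_one.of_isClosed_subset ?_ ?_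
  · exact isClosed_posSemidef.inter (isClosed_eq continuous_id.matrix_trace continuous_const)
  · rintro P ⟨hP, hP1⟩ i j
    have hd : ∀ i, (P i i).re ≤ 1 := by
      intro i
      have h1 : ∑ i, (P i i).re = 1 := by
        rw [← Complex.re_sum]
        exact (congrArg Complex.re hP1).trans Complex.one_re
      rw [← h1]
      exact Finset.single_le_sum (f := fun i => (P i i).re) (fun i _ => diag_re_nonneg hP i)
        (Finset.mem_univ i)
    linarith [norm_entry_le hP i j, hd i, hd j]

lemma isCompact_povm {M : ℕ} [DecidableEq n] :
    IsCompact {E : Fin M → Matrix n n ℂ | (∀ m, (E m).PosSemidef) ∧ ∑ m, E m = 1} := by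
  have hc : IsCompact (Set.univ.pi fun _ : Fin M => {P : Matrix n n ℂ | ∀ i j, ‖P i j‖ ≤ 1}) :=
    isCompact_univ_pi fun _ => isCompact_entries_le_one
  refine hc.of_isClosed_subset ?_ ?_
  · have h1 : IsClosed {E : Fin M → Matrix n n ℂ | ∀ m, (E m).PosSemidef} := by
      have : {E : Fin M → Matrix n n ℂ | ∀ m, (E m).PosSemidef} =
          ⋂ m, (fun E : Fin M → Matrix n n ℂ => E m) ⁻¹' {P | P.PosSemidef} := by
        ext E; simp
      rw [this]
      exact isClosed_iInter fun m => isClosed_posSemidef.preimage (continuous_apply m)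
    exact h1.inter (isClosed_eq (continuous_finsetSum _ fun m _ => continuous_apply m)
      continuous_const)
  · rintro E ⟨hE, hE1⟩ m - i j
    have hd : ∀ i, (E m i i).re ≤ 1 := by
      intro i
      have h1 : ∑ m, (E m i i).re = 1 := by
        rw [← Complex.re_sum, ← Matrix.sum_apply, hE1]; simp
      rw [← h1]
      exact Finset.single_le_sum (f := fun m => (E m i i).re)
        (fun m _ => diag_re_nonneg (hE m) i) (Finset.mem_univ m)
    linarith [norm_entry_le (hE m) i j, hd i, hd j]

lemma isCompact_unit_vectors : IsCompact {ψ : n → ℂ | ∑ p, ‖ψ p‖ ^ 2 = 1} := by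
  have hc : IsCompact (Set.univ.pi fun _ : n => Metric.closedBall (0 : ℂ) 1) :=
    isCompact_univ_pi fun _ => isCompact_closedBall _ _
  refine hc.of_isClosed_subset (isClosed_eq (by fun_prop) continuous_const) ?_
  intro ψ hψ p _
  have : ‖ψ p‖ ^ 2 ≤ 1 := by
    rw [← show _ = _ from hψ]
    exact Finset.single_le_sum (f := fun p => ‖ψ p‖ ^ 2) (fun p _ => by positivity)
      (Finset.mem_univ p)
  rw [mem_closedBall_zero_iff]
  nlinarith [norm_nonneg (ψ p)]

end Compactness

/-! ### Protocols as channels and their mixtures -/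

section Protocols

variable {A B K : Type*} [Fintype A] [Fintype K] [DecidableEq K]

lemma bobState_apply (ψ : K × K → ℂ) (E : Matrix (A × K) (A × K) ℂ) (X : Matrix A A ℂ)
    (k k' : K) : bobState ψ E X k k' = ∑ a, ∑ l, ∑ a', ∑ l',
      E (a, l) (a', l') * (X a' a * (ψ (l', k) * star (ψ (l, k')))) := by
  simp [bobState, trLeft, Matrix.mul_apply, Fintype.sum_prod_type, kroneckerMap_apply, proj,
    vecMulVec_apply, Matrix.one_apply]

/-- `bobState` as a linear map of Alice's input. -/
def bobMap (ψ : K × K → ℂ) (E : Matrix (A × K) (A × K) ℂ) :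
    Matrix A A ℂ →ₗ[ℂ] Matrix K K ℂ where
  toFun := bobState ψ E
  map_add' X Y := by
    ext k k'
    simp only [bobState_apply, Matrix.add_apply, add_mul, mul_add, Finset.sum_add_distrib]
  map_smul' c X := by
    ext k k'
    simp only [bobState_apply, Matrix.smul_apply, smul_eq_mul, RingHom.id_apply, Finset.mul_sum]
    refine Finset.sum_congr rfl fun a _ => Finset.sum_congr rfl fun l _ =>
      Finset.sum_congr rfl fun a' _ => Finset.sum_congr rfl fun l' _ => by ring

lemma bobMap_apply (ψ : K × K → ℂ) (E : Matrix (A × K) (A × K) ℂ) (X : Matrix A A ℂ) :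
    bobMap ψ E X = bobState ψ E X := rfl

/-- The map implemented by a protocol with entangled systems indexed by `K`. -/
def protocolMap {M : ℕ} (ψ : K × K → ℂ) (E : Fin M → Matrix (A × K) (A × K) ℂ)
    (Φ : Fin M → (Matrix K K ℂ →ₗ[ℂ] Matrix B B ℂ)) : Matrix A A ℂ →ₗ[ℂ] Matrix B B ℂ :=
  ∑ m, Φ m ∘ₗ bobMap ψ (E m)

lemma protocolMap_apply {M : ℕ} (ψ : K × K → ℂ) (E : Fin M → Matrix (A × K) (A × K) ℂ)
    (Φ : Fin M → (Matrix K K ℂ →ₗ[ℂ] Matrix B B ℂ)) (X : Matrix A A ℂ) :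
    protocolMap ψ E Φ X = ∑ m, Φ m (bobState ψ (E m) X) := by
  simp [protocolMap, bobMap_apply]

/-- The entangled systems of a protocol may be indexed by any finite type. -/
lemma protocolMap_mem_eLOCC [DecidableEq A] [Fintype B] {M : ℕ} {ψ : K × K → ℂ}
    {E : Fin M → Matrix (A × K) (A × K) ℂ} {Φ : Fin M → (Matrix K K ℂ →ₗ[ℂ] Matrix B B ℂ)}
    (hψ : ∑ p, ‖ψ p‖ ^ 2 = 1) (hE : ∀ m, (E m).PosSemidef) (hE1 : ∑ m, E m = 1)
    (hΦ : ∀ m, IsChannel (Φ m)) : protocolMap ψ E Φ ∈ eLOCC A B M := by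
  have e := (Fintype.equivFin K).symm
  let f : A × Fin (Fintype.card K) ≃ A × K := (Equiv.refl A).prodCongr e
  let R : Matrix (Fin (Fintype.card K)) (Fin (Fintype.card K)) ℂ →ₗ[ℂ] Matrix K K ℂ :=
    (Matrix.reindexLinearEquiv ℂ ℂ e e).toLinearMap
  refine ⟨Fintype.card K, fun p => ψ (e p.1, e p.2), fun m => (E m).submatrix f f,
    fun m => Φ m ∘ₗ R, ?_, fun m => (hE m).submatrix f, ?_, fun m => ⟨fun d X hX => ?_, ?_⟩, ?_⟩
  · rw [← hψ]
    exact (e.prodCongr e).sum_comp fun p => ‖ψ p‖ ^ 2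
  · have : ∑ m, (E m).submatrix f f = (∑ m, E m).submatrix f f := by
      ext p q; simp [Matrix.sum_apply]
    rw [this, hE1, submatrix_one_equiv]
  · have h := (hΦ m).completelyPositive d _
      (hX.submatrix ((Equiv.refl (Fin d)).prodCongr e.symm))
    exact h
  · intro X
    rw [LinearMap.comp_apply, (hΦ m).tracePreserving]
    exact e.symm.sum_comp fun i => X i i
  · intro X
    rw [protocolMap_apply]
    refine Finset.sum_congr rfl fun m _ => ?_
    rw [LinearMap.comp_apply]
    congr 1
    ext k k'
    simp only [R, LinearEquiv.coe_coe, Matrix.coe_reindexLinearEquiv, Matrix.reindex_apply,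
      submatrix_apply, bobState_apply]
    refine Finset.sum_congr rfl fun a _ => ?_
    rw [← e.sum_comp]
    refine Finset.sum_congr rfl fun l _ => Finset.sum_congr rfl fun a' _ => ?_
    rw [← e.sum_comp]
    refine Finset.sum_congr rfl fun l' _ => ?_
    simp [f]

/-- Complete positivity of `bobMap`: a factorization `E = Gᴴ G` gives its Kraus operators. -/
lemma idTensor_bobMap_posSemidef {R : Type*} [Fintype R] [DecidableEq R] (ψ : K × K → ℂ)
    {E : Matrix (A × K) (A × K) ℂ} (hE : E.PosSemidef) {X : Matrix (R × A) (R × A) ℂ}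
    (hX : X.PosSemidef) : (idTensor R (bobMap ψ E) X).PosSemidef := by
  classical
  obtain ⟨G, hG⟩ : ∃ G : Matrix (A × K) (A × K) ℂ, E = Gᴴ * G :=
    ⟨CFC.sqrt E, by rw [sqrt_conjTranspose, sqrt_mul_sqrt hE]⟩
  let Y : A × K → Matrix (R × K) (R × A) ℂ := fun j => Matrix.of fun p q =>
    if p.1 = q.1 then ∑ l, G j (q.2, l) * ψ (l, p.2) else 0
  have h : idTensor R (bobMap ψ E) X = ∑ j, Y j * X * (Y j)ᴴ := by
    ext ⟨r, k⟩ ⟨r', k'⟩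
    have e1 : ∀ j, (Y j * X * (Y j)ᴴ) (r, k) (r', k') = ∑ a, ∑ l, ∑ a', ∑ l',
        star (G j (a, l)) * G j (a', l') * (X (r, a') (r', a) * (ψ (l', k) * star (ψ (l, k')))) := by
      intro j
      simp only [Y, Matrix.mul_apply, Fintype.sum_prod_type (γ := ℂ), of_apply, conjTranspose_apply,
        ite_mul, zero_mul, Finset.sum_ite_irrel, Finset.sum_const_zero, Finset.sum_ite_eq,
        Finset.mem_univ, if_true, apply_ite star, star_zero, mul_ite, mul_zero, star_sum, star_mul',
        Finset.mul_sum, Finset.sum_mul]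
      refine Finset.sum_congr rfl fun a _ => Finset.sum_congr rfl fun l _ =>
        Finset.sum_congr rfl fun a' _ => Finset.sum_congr rfl fun l' _ => by ring
    rw [Matrix.sum_apply]
    simp only [e1]
    simp only [idTensor, of_apply, bobMap_apply, bobState_apply, hG, Matrix.mul_apply,
      conjTranspose_apply, Finset.sum_mul]
    symm
    rw [Finset.sum_comm]
    refine Finset.sum_congr rfl fun a _ => ?_
    rw [Finset.sum_comm]
    refine Finset.sum_congr rfl fun l _ => ?_
    rw [Finset.sum_comm]
    refine Finset.sum_congr rfl fun a' _ => ?_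
    rw [Finset.sum_comm]
  rw [h]
  exact posSemidef_sum (Finset.univ : Finset (A × K)) fun j _ => hX.mul_mul_conjTranspose_same (Y j)

lemma sum_trace_bobState {M : ℕ} [DecidableEq A] {ψ : K × K → ℂ}
    {E : Fin M → Matrix (A × K) (A × K) ℂ} (hψ : ∑ p, ‖ψ p‖ ^ 2 = 1) (hE1 : ∑ m, E m = 1)
    (X : Matrix A A ℂ) : ∑ m, (bobState ψ (E m) X).trace = X.trace := by
  have h1 : ∑ m, bobState ψ (E m) X = bobState ψ (1 : Matrix (A × K) (A × K) ℂ) X := by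
    ext k k'
    rw [Matrix.sum_apply, ← hE1]
    simp only [bobState_apply, Matrix.sum_apply, Finset.sum_mul]
    rw [Finset.sum_comm]
    refine Finset.sum_congr rfl fun a _ => ?_
    rw [Finset.sum_comm]
    refine Finset.sum_congr rfl fun l _ => ?_
    rw [Finset.sum_comm]
    refine Finset.sum_congr rfl fun a' _ => ?_
    rw [Finset.sum_comm]
  have hψ' : ∑ k, ∑ l, ψ (l, k) * star (ψ (l, k)) = 1 := by
    have : ((∑ p, ‖ψ p‖ ^ 2 : ℝ) : ℂ) = 1 := by rw [hψ]; simp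
    rw [← this, Fintype.sum_prod_type, Finset.sum_comm]
    push_cast
    refine Finset.sum_congr rfl fun l _ => Finset.sum_congr rfl fun k _ => ?_
    rw [Complex.star_def, Complex.mul_conj']
  rw [← trace_sum, h1]
  have h2 : ∀ k, bobState ψ (1 : Matrix (A × K) (A × K) ℂ) X k k =
      X.trace * ∑ l, ψ (l, k) * star (ψ (l, k)) := by
    intro k
    rw [bobState_apply]
    simp only [Matrix.one_apply, Prod.mk.injEq, ite_mul, one_mul, zero_mul, ite_and,
      Finset.sum_ite_irrel, Finset.sum_const_zero, Finset.sum_ite_eq, Finset.mem_univ, if_true,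
      Matrix.trace, diag_apply, Finset.sum_mul, Finset.mul_sum]
    rw [Finset.sum_comm]
  simp only [Matrix.trace, diag_apply] at h2 ⊢
  simp only [h2, ← Finset.mul_sum, hψ', mul_one]

/-- Every eLOCC protocol implements a channel. -/
lemma isChannel_of_mem_eLOCC [DecidableEq A] [Fintype B] [DecidableEq B] {M : ℕ}
    {T : Matrix A A ℂ →ₗ[ℂ] Matrix B B ℂ} (hT : T ∈ eLOCC A B M) : IsChannel T := by
  obtain ⟨d, ψ, E, Φ, hψ, hE, hE1, hΦ, h⟩ := hT
  refine ⟨fun D X hX => ?_, fun X => ?_⟩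
  · have e : idTensor (Fin D) T X =
        ∑ m, idTensor (Fin D) (Φ m) (idTensor (Fin D) (bobMap ψ (E m)) X) := by
      ext ⟨r, b⟩ ⟨r', b'⟩
      simp only [idTensor, of_apply, h, Matrix.sum_apply]
      rfl
    rw [e]
    exact posSemidef_sum _ fun m _ =>
      (hΦ m).completelyPositive D _ (idTensor_bobMap_posSemidef ψ (hE m) hX)
  · rw [h, trace_sum]
    simp only [(hΦ _).tracePreserving]
    exact sum_trace_bobState hψ hE1 X

lemma posSemidef_fromBlocks_diag {m n : Type*} [Fintype m] [Fintype n] {P : Matrix m m ℂ}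
    {Q : Matrix n n ℂ} (hP : P.PosSemidef) (hQ : Q.PosSemidef) :
    (fromBlocks P 0 0 Q).PosSemidef := by
  classical
  have : fromBlocks P 0 0 Q = (fromBlocks (CFC.sqrt P) 0 0 (CFC.sqrt Q))ᴴ *
      fromBlocks (CFC.sqrt P) 0 0 (CFC.sqrt Q) := by
    rw [fromBlocks_conjTranspose, fromBlocks_multiply]
    simp [sqrt_conjTranspose, sqrt_mul_sqrt hP, sqrt_mul_sqrt hQ]
  rw [this]
  exact posSemidef_conjTranspose_mul_self _

/-- Mixtures of protocols are protocols: the shared state is the weighted direct sum of the two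
shared states, and both parties learn the summand by a local projection, without communication. -/
lemma combo_mem_eLOCC [DecidableEq A] [Fintype B] {M : ℕ}
    {T₁ T₂ : Matrix A A ℂ →ₗ[ℂ] Matrix B B ℂ} (h₁ : T₁ ∈ eLOCC A B M) (h₂ : T₂ ∈ eLOCC A B M)
    {a b : ℝ} (ha : 0 ≤ a) (hb : 0 ≤ b) (hab : a + b = 1) :
    (a : ℂ) • T₁ + (b : ℂ) • T₂ ∈ eLOCC A B M := by
  obtain ⟨d₁, ψ₁, E₁, Φ₁, hψ₁, hE₁, hE₁', hΦ₁, h₁⟩ := h₁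
  obtain ⟨d₂, ψ₂, E₂, Φ₂, hψ₂, hE₂, hE₂', hΦ₂, h₂⟩ := h₂
  let ψ : (Fin d₁ ⊕ Fin d₂) × (Fin d₁ ⊕ Fin d₂) → ℂ := fun p =>
    match p with
    | (Sum.inl i, Sum.inl j) => (√a : ℝ) * ψ₁ (i, j)
    | (Sum.inr i, Sum.inr j) => (√b : ℝ) * ψ₂ (i, j)
    | _ => 0
  let f := Equiv.prodSumDistrib A (Fin d₁) (Fin d₂)
  let E : Fin M → Matrix (A × (Fin d₁ ⊕ Fin d₂)) (A × (Fin d₁ ⊕ Fin d₂)) ℂ := fun m =>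
    (fromBlocks (E₁ m) 0 0 (E₂ m)).submatrix f f
  let b₁ : Matrix (Fin d₁ ⊕ Fin d₂) (Fin d₁ ⊕ Fin d₂) ℂ →ₗ[ℂ] Matrix (Fin d₁) (Fin d₁) ℂ :=
    { toFun := fun X => X.submatrix Sum.inl Sum.inl
      map_add' := fun _ _ => rfl
      map_smul' := fun _ _ => rfl }
  let b₂ : Matrix (Fin d₁ ⊕ Fin d₂) (Fin d₁ ⊕ Fin d₂) ℂ →ₗ[ℂ] Matrix (Fin d₂) (Fin d₂) ℂ :=
    { toFun := fun X => X.submatrix Sum.inr Sum.inr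
      map_add' := fun _ _ => rfl
      map_smul' := fun _ _ => rfl }
  have hT : (a : ℂ) • T₁ + (b : ℂ) • T₂ =
      protocolMap ψ E fun m => Φ₁ m ∘ₗ b₁ + Φ₂ m ∘ₗ b₂ := by
    refine LinearMap.ext fun X => ?_
    have sq : ∀ {c : ℝ}, 0 ≤ c → ((√c : ℝ) : ℂ) * ((√c : ℝ) : ℂ) = c := fun {c} hc => by
      rw [← Complex.ofReal_mul, Real.mul_self_sqrt hc]
    have e₁ : ∀ m, b₁ (bobState ψ (E m) X) = (a : ℂ) • bobState ψ₁ (E₁ m) X := by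
      intro m
      ext k k'
      change bobState ψ (E m) X (Sum.inl k) (Sum.inl k') = _
      simp only [bobState_apply, Matrix.smul_apply, Fintype.sum_sum_type]
      simp only [E, f, ψ, submatrix_apply, Equiv.prodSumDistrib_apply_left,
        Equiv.prodSumDistrib_apply_right, fromBlocks_apply₁₁, fromBlocks_apply₁₂,
        fromBlocks_apply₂₁, fromBlocks_apply₂₂, Matrix.zero_apply, zero_mul, mul_zero,
        Finset.sum_const_zero, add_zero, smul_eq_mul, Finset.mul_sum, star_mul',
        Complex.star_def, Complex.conj_ofReal, ← sq ha]
      refine Finset.sum_congr rfl fun a _ => Finset.sum_congr rfl fun l _ =>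
        Finset.sum_congr rfl fun a' _ => Finset.sum_congr rfl fun l' _ => by ring
    have e₂ : ∀ m, b₂ (bobState ψ (E m) X) = (b : ℂ) • bobState ψ₂ (E₂ m) X := by
      intro m
      ext k k'
      change bobState ψ (E m) X (Sum.inr k) (Sum.inr k') = _
      simp only [bobState_apply, Matrix.smul_apply, Fintype.sum_sum_type]
      simp only [E, f, ψ, submatrix_apply, Equiv.prodSumDistrib_apply_left,
        Equiv.prodSumDistrib_apply_right, fromBlocks_apply₁₁, fromBlocks_apply₁₂,
        fromBlocks_apply₂₁, fromBlocks_apply₂₂, Matrix.zero_apply, zero_mul, mul_zero, star_zero,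
        Finset.sum_const_zero, add_zero, zero_add, smul_eq_mul, Finset.mul_sum, star_mul',
        Complex.star_def, Complex.conj_ofReal, ← sq hb]
      refine Finset.sum_congr rfl fun a _ => Finset.sum_congr rfl fun l _ =>
        Finset.sum_congr rfl fun a' _ => Finset.sum_congr rfl fun l' _ => by ring
    rw [protocolMap_apply]
    simp only [LinearMap.add_apply, LinearMap.smul_apply, LinearMap.comp_apply, e₁, e₂, map_smul,
      h₁, h₂, Finset.sum_add_distrib, Finset.smul_sum]
  rw [hT]
  refine protocolMap_mem_eLOCC ?_
    (fun m => (posSemidef_fromBlocks_diag (hE₁ m) (hE₂ m)).submatrix f) ?_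
    (fun m => ⟨fun d X hX => ?_, fun X => ?_⟩)
  · rw [Fintype.sum_prod_type] at hψ₁ hψ₂
    simp only [Fintype.sum_prod_type, Fintype.sum_sum_type, ψ, norm_mul, mul_pow, norm_zero,
      ne_eq, OfNat.ofNat_ne_zero, not_false_eq_true, zero_pow, Finset.sum_const_zero, add_zero,
      zero_add, Complex.norm_real, Real.norm_eq_abs, sq_abs, Real.sq_sqrt ha, Real.sq_sqrt hb,
      ← Finset.mul_sum, hψ₁, hψ₂, mul_one, hab]
  · have : ∑ m, E m = (fromBlocks (∑ m, E₁ m) 0 0 (∑ m, E₂ m)).submatrix f f := by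
      ext ⟨a, i | i⟩ ⟨a', j | j⟩ <;> simp [E, f, Matrix.sum_apply]
    rw [this, hE₁', hE₂', fromBlocks_one, submatrix_one_equiv]
  · have p₁ := (hΦ₁ m).completelyPositive d _
      (hX.submatrix (fun p : Fin d × Fin d₁ => (p.1, Sum.inl p.2)))
    have p₂ := (hΦ₂ m).completelyPositive d _
      (hX.submatrix (fun p : Fin d × Fin d₂ => (p.1, Sum.inr p.2)))
    exact p₁.add p₂
  · rw [LinearMap.add_apply, trace_add, LinearMap.comp_apply, LinearMap.comp_apply,
      (hΦ₁ m).tracePreserving, (hΦ₂ m).tracePreserving]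
    exact (Fintype.sum_sum_type fun i => X i i).symm

end Protocols

/-! ### Protocols in which Bob keeps one of `M` copies -/

section SlotProtocols

variable {A B : Type*} [Fintype A] [DecidableEq A] [Fintype B] [DecidableEq B] {M : ℕ}

/-- Bob's decoder: keep the `m`-th copy of `B`. -/
def keepSlot (B : Type*) [Fintype B] [DecidableEq B] (m : Fin M) :
    Matrix (Fin M → B) (Fin M → B) ℂ →ₗ[ℂ] Matrix B B ℂ where
  toFun X := trRight (X.submatrix (Equiv.funSplitAt m B).symm (Equiv.funSplitAt m B).symm)
  map_add' X Y := by
    ext b b'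
    simp [trRight, Finset.sum_add_distrib]
  map_smul' c X := by
    ext b b'
    simp [trRight, Finset.mul_sum]

lemma idTensor_keepSlot {R : Type*} (m : Fin M)
    (X : Matrix (R × (Fin M → B)) (R × (Fin M → B)) ℂ) :
    idTensor R (keepSlot B m) X = margin m X := rfl

lemma isChannel_keepSlot (m : Fin M) : IsChannel (keepSlot B m) := by
  refine ⟨fun d X hX => ?_, fun X => ?_⟩
  · rw [idTensor_keepSlot]
    have : X = CFC.sqrt X * (CFC.sqrt X)ᴴ := by rw [sqrt_conjTranspose, sqrt_mul_sqrt hX]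
    rw [this, ← marginFactor_mul]
    exact posSemidef_self_mul_conjTranspose _
  · exact (trace_trRight _).trans (trace_submatrix_equiv _ X)

/-- The protocol with shared state `ψ` on `M` copies of `B` at each side, in which Bob outputs the
copy named by the outcome of Alice's measurement `E`. -/
def slotProtocol (ψ : (Fin M → B) × (Fin M → B) → ℂ)
    (E : Fin M → Matrix (A × (Fin M → B)) (A × (Fin M → B)) ℂ) :
    Matrix A A ℂ →ₗ[ℂ] Matrix B B ℂ :=
  protocolMap ψ E (keepSlot B)

/-- The Choi matrices of the slot protocols. -/
def slotChoi (A B : Type*) [Fintype A] [DecidableEq A] [Fintype B] [DecidableEq B] (M : ℕ) :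
    Set (Matrix (A × B) (A × B) ℂ) :=
  (fun p : ((Fin M → B) × (Fin M → B) → ℂ) ×
      (Fin M → Matrix (A × (Fin M → B)) (A × (Fin M → B)) ℂ) =>
    jointOutput (slotProtocol p.1 p.2) 1) ''
    ({ψ | ∑ p, ‖ψ p‖ ^ 2 = 1} ×ˢ {E | (∀ m, (E m).PosSemidef) ∧ ∑ m, E m = 1})

lemma isCompact_slotChoi : IsCompact (slotChoi A B M) := by
  refine (isCompact_unit_vectors.prod isCompact_povm).image ?_
  refine continuous_matrix fun p q => ?_
  obtain ⟨r, b⟩ := p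
  obtain ⟨r', b'⟩ := q
  simp only [jointOutput_apply, slotProtocol, protocolMap_apply, Matrix.sum_apply]
  refine continuous_finsetSum _ fun m _ => ?_
  refine Continuous.matrix_elem ?_ b b'
  refine (LinearMap.continuous_of_finiteDimensional (keepSlot B m)).comp ?_
  refine continuous_matrix fun k k' => ?_
  simp only [bobState_apply]
  refine continuous_finsetSum _ fun a _ => continuous_finsetSum _ fun l _ =>
    continuous_finsetSum _ fun a' _ => continuous_finsetSum _ fun l' _ => ?_
  have h1 : ∀ l k, Continuous fun p : ((Fin M → B) × (Fin M → B) → ℂ) ×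
      (Fin M → Matrix (A × (Fin M → B)) (A × (Fin M → B)) ℂ) => p.1 (l, k) :=
    fun l k => (continuous_apply (l, k)).comp continuous_fst
  have h2 : Continuous fun p : ((Fin M → B) × (Fin M → B) → ℂ) ×
      (Fin M → Matrix (A × (Fin M → B)) (A × (Fin M → B)) ℂ) => p.2 m (a, l) (a', l') :=
    ((continuous_apply m).comp continuous_snd).matrix_elem _ _
  exact h2.mul (continuous_const.mul ((h1 l' k).mul (h1 l k').star))

/-- The Choi matrices of the eLOCC protocols. -/
def eLOCCChoi (A B : Type*) [Fintype A] [DecidableEq A] [Fintype B] [DecidableEq B] (M : ℕ) :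
    Set (Matrix (A × B) (A × B) ℂ) :=
  (fun T => jointOutput T 1) '' eLOCC A B M

lemma convex_eLOCCChoi : Convex ℝ (eLOCCChoi A B M) := by
  rintro _ ⟨T₁, h₁, rfl⟩ _ ⟨T₂, h₂, rfl⟩ a b ha hb hab
  refine ⟨_, combo_mem_eLOCC h₁ h₂ ha hb hab, ?_⟩
  ext ⟨r, b⟩ ⟨r', b'⟩
  simp [jointOutput_apply]

lemma posSemidef_of_mem_eLOCCChoi {J : Matrix (A × B) (A × B) ℂ} (hJ : J ∈ eLOCCChoi A B M) :
    J.PosSemidef := by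
  obtain ⟨T, hT, rfl⟩ := hJ
  exact (isChannel_of_mem_eLOCC hT).jointOutput_posSemidef 1

lemma convexHull_slotChoi_subset : convexHull ℝ (slotChoi A B M) ⊆ eLOCCChoi A B M := by
  refine convexHull_min ?_ convex_eLOCCChoi
  rintro _ ⟨⟨ψ, E⟩, ⟨hψ, hE, hE1⟩, rfl⟩
  exact ⟨_, protocolMap_mem_eLOCC hψ hE hE1 isChannel_keepSlot, rfl⟩

/-- The joint output of a slot protocol whose shared state is the canonical purification of `s²` for
a Hermitian `s`. The transposes come from the maximally entangled vector. -/
lemma jointOutput_slotProtocol (ρ : Matrix A A ℂ) {s : Matrix (Fin M → B) (Fin M → B) ℂ}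
    (hs : sᴴ = s) (E : Fin M → Matrix (A × (Fin M → B)) (A × (Fin M → B)) ℂ) :
    jointOutput (slotProtocol (fun p => s p.2 p.1) E) ρ =
      ∑ m, margin m ((CFC.sqrt ρ ⊗ₖ s) * (E m)ᵀ * (CFC.sqrt ρ ⊗ₖ s)) := by
  have h1 : jointOutput (slotProtocol (fun p => s p.2 p.1) E) ρ =
      ∑ m, idTensor A (keepSlot B m)
        (idTensor A (bobMap (fun p => s p.2 p.1) (E m)) (purification ρ)) := by
    ext ⟨r, b⟩ ⟨r', b'⟩
    rw [jointOutput_apply, slotProtocol, protocolMap_apply, Matrix.sum_apply, Matrix.sum_apply]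
    simp only [idTensor, of_apply, bobMap_apply, purification_apply]
    rfl
  have hs' : ∀ k l, star (s k l) = s l k := fun k l => by
    rw [← conjTranspose_apply, hs]
  rw [h1]
  refine Finset.sum_congr rfl fun m _ => ?_
  rw [idTensor_keepSlot]
  congr 1
  ext ⟨r, k⟩ ⟨r', k'⟩
  simp only [idTensor, of_apply, bobMap_apply, purification_apply, bobState_apply,
    Matrix.mul_apply, Fintype.sum_prod_type (γ := ℂ), kroneckerMap_apply, transpose_apply, hs',
    Finset.sum_mul]
  refine Finset.sum_congr rfl fun a _ => Finset.sum_congr rfl fun l _ =>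
    Finset.sum_congr rfl fun a' _ => Finset.sum_congr rfl fun l' _ => by ring

end SlotProtocols

/-! ### Combining the two errors -/

section Scalars

/-- A form of `sin (x + y) ≤ sin x + sin y`, for angles with sines `η` and `δ`; the cosine of the
second one is replaced by the larger `1 - δ² / 2`. -/
lemma sqrt_one_sub_sq_le {η δ : ℝ} (hη : 0 ≤ η) (hδ : 0 ≤ δ) (h : η + δ ≤ 1) :
    √(1 - (η + δ) ^ 2) ≤ √(1 - η ^ 2) * (1 - δ ^ 2 / 2) -
      √(1 - √(1 - η ^ 2) ^ 2) * √(1 - (1 - δ ^ 2 / 2) ^ 2) := by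
  have hη1 : 0 ≤ 1 - η ^ 2 := by nlinarith
  have hδ1 : 0 ≤ 1 - δ ^ 2 := by nlinarith
  have hs1 : 0 ≤ 1 - (η + δ) ^ 2 := by nlinarith
  have e1 : √(1 - √(1 - η ^ 2) ^ 2) = η := by
    rw [Real.sq_sqrt hη1, sub_sub_cancel, Real.sqrt_sq hη]
  have e2 : √(1 - (1 - δ ^ 2 / 2) ^ 2) ≤ δ :=
    Real.sqrt_le_iff.2 ⟨hδ, by nlinarith [sq_nonneg (δ ^ 2)]⟩
  have e3 : √(1 - δ ^ 2) ≤ 1 - δ ^ 2 / 2 :=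
    Real.sqrt_le_iff.2 ⟨by nlinarith, by nlinarith [sq_nonneg (δ ^ 2)]⟩
  have e4 : √(1 - (η + δ) ^ 2) + η * δ ≤ √(1 - η ^ 2) * √(1 - δ ^ 2) := by
    rw [← Real.sqrt_mul hη1]
    apply Real.le_sqrt_of_sq_le
    have hs : √(1 - (η + δ) ^ 2) ≤ 1 := Real.sqrt_le_one.2 (by nlinarith [sq_nonneg (η + δ)])
    nlinarith [Real.sq_sqrt hs1, mul_nonneg (mul_nonneg hη hδ) (sub_nonneg.2 hs)]
  rw [e1]
  nlinarith [mul_le_mul_of_nonneg_left e3 (Real.sqrt_nonneg (1 - η ^ 2)),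
    mul_le_mul_of_nonneg_left e2 hη]

end Scalars

/-! ### Density operators -/

section States

variable {n : Type*} [Fintype n] [DecidableEq n]

/-- The maximally mixed state. -/
def maxMixed (n : Type*) [Fintype n] [DecidableEq n] : Matrix n n ℂ :=
  ((Fintype.card n : ℝ)⁻¹ : ℝ) • (1 : Matrix n n ℂ)

lemma maxMixed_posDef [Nonempty n] : (maxMixed n).PosDef := by
  have : (0 : ℝ) < Fintype.card n := by exact_mod_cast Fintype.card_pos
  exact PosDef.one.smul (inv_pos.2 this)

lemma maxMixed_mem_density [Nonempty n] : maxMixed n ∈ density n := by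
  refine ⟨maxMixed_posDef.posSemidef, ?_⟩
  have : (Fintype.card n : ℂ) ≠ 0 := by exact_mod_cast Fintype.card_ne_zero
  simp [maxMixed, trace_smul, this]

/-- Mixing with a positive definite operator gives a positive definite operator. -/
lemma posDef_mix {P Q : Matrix n n ℂ} (hP : P.PosSemidef) (hQ : Q.PosDef) {t : ℝ} (ht : 0 < t)
    (ht1 : t ≤ 1) : ((1 - t) • P + t • Q).PosDef :=
  PosDef.posSemidef_add (hP.smul (sub_nonneg.2 ht1)) (hQ.smul ht)

lemma rootFidelity_le_one {P Q : Matrix n n ℂ} (hP : P ∈ density n) (hQ : Q ∈ density n) :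
    rootFidelity P Q ≤ 1 := by
  have hs : CFC.sqrt P * (CFC.sqrt P)ᴴ = P := by rw [sqrt_conjTranspose, sqrt_mul_sqrt hP.1]
  obtain ⟨Y, hY, h⟩ := exists_purification_rootFidelity_eq (CFC.sqrt P) hQ.1
  have := two_mul_re_trace_le (CFC.sqrt P) Y
  rw [h, hs, hY, hP.2, hQ.2, Complex.one_re] at this
  linarith

end States

/-! ### Simulation of a channel -/

section Simulation

variable {A B : Type*} [Fintype A] [DecidableEq A] [Fintype B] [DecidableEq B] {M : ℕ}

lemma kronecker_mem_density {ρ : Matrix A A ℂ} {σ : Matrix B B ℂ} (hρ : ρ ∈ density A)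
    (hσ : σ ∈ density B) : ρ ⊗ₖ σ ∈ density (A × B) :=
  ⟨hρ.1.kronecker hσ.1, by rw [trace_kronecker, hρ.2, hσ.2, one_mul]⟩

lemma trRight_kronecker (ρ : Matrix A A ℂ) (σ : Matrix B B ℂ) :
    trRight (ρ ⊗ₖ σ) = σ.trace • ρ := by
  ext i j
  simp [trRight, kroneckerMap_apply, Matrix.trace, ← Finset.mul_sum, mul_comm]

/-- Simulation of a strictly positive state `τ` by a slot protocol. -/
lemma exists_slotProtocol_rootFidelity_ge (hM : 0 < M) {ρ : Matrix A A ℂ} {σ : Matrix B B ℂ}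
    {τ : Matrix (A × B) (A × B) ℂ} (hρ : ρ.PosDef) (hσ : σ.PosDef) (hσ1 : σ.trace = 1)
    (hτ : τ.PosDef) (hτ1 : τ.trace = 1) (hτρ : trRight τ = ρ) {k : ℝ} (hk : 0 < k)
    (h : ((k : ℂ) • (ρ ⊗ₖ σ) - τ).PosSemidef) :
    ∃ ψ E, ∑ p, ‖ψ p‖ ^ 2 = 1 ∧ (∀ m, (E m).PosSemidef) ∧ ∑ m, E m = 1 ∧
      1 - k / (2 * M) ≤ rootFidelity τ (jointOutput (slotProtocol (A := A) (B := B) (M := M) ψ E) ρ)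
      := by
  have : Nonempty (Fin M) := ⟨⟨0, hM⟩⟩
  obtain ⟨E, hE, hE1, hF⟩ := exists_measurement (ι := Fin M) hρ hσ hσ1 hτ hτ1 hτρ hk h
  set s := CFC.sqrt (tensorPow (Fin M) σ) with hs
  have hsH : sᴴ = s := sqrt_conjTranspose _
  refine ⟨fun p => s p.2 p.1, fun m => (E m)ᵀ, ?_, fun m => (hE m).transpose, ?_, ?_⟩
  · have h1 : (s * sᴴ).trace = 1 := by
      rw [hsH, hs, sqrt_mul_sqrt (tensorPow_posSemidef hσ.posSemidef), trace_tensorPow, hσ1,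
        one_pow]
    have h2 : (s * sᴴ).trace = ((∑ p : (Fin M → B) × (Fin M → B), ‖s p.2 p.1‖ ^ 2 : ℝ) : ℂ) := by
      rw [Fintype.sum_prod_type, Finset.sum_comm]
      push_cast
      simp only [Matrix.trace, diag_apply, Matrix.mul_apply, conjTranspose_apply,
        Complex.star_def, Complex.mul_conj']
    rw [h1] at h2
    exact_mod_cast h2.symm
  · rw [← transpose_sum, hE1, transpose_one]
  · rw [jointOutput_slotProtocol ρ hsH]
    simpa using hF

/-- The simulation of the channel `N` for a strictly positive input `ρ`, from a smoothed state `τ`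
with `τ ≤ k (ρ ⊗ σ)`. Both `σ` and `τ` are mixed with weight `t` to make them strictly positive. -/
lemma exists_slotChoi_choiFidelity_ge [Nonempty B] (hM : 0 < M)
    {N : Matrix A A ℂ →ₗ[ℂ] Matrix B B ℂ} (hN : IsChannel N) {ρ : Matrix A A ℂ} {σ : Matrix B B ℂ}
    {τ : Matrix (A × B) (A × B) ℂ} (hρ : ρ.PosDef) (hρ1 : ρ.trace = 1) (hσ : σ ∈ density B)
    (hτ : τ ∈ density (A × B)) (hτρ : trRight τ = ρ) {k : ℝ} (hk : 0 < k)
    (h : ((k : ℂ) • (ρ ⊗ₖ σ) - τ).PosSemidef) {t : ℝ} (ht : 0 < t) (ht1 : t < 1) {a b : ℝ}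
    (ha : 0 ≤ a) (haF : a ≤ rootFidelity τ (jointOutput N ρ)) (hb : 0 ≤ b)
    (hbk : b ≤ 1 - k / (1 - t) / (2 * M)) :
    ∃ J ∈ slotChoi A B M, (1 - t) * a * b - √(1 - ((1 - t) * a) ^ 2) * √(1 - b ^ 2) ≤
      choiFidelity ρ (jointOutput N 1) J := by
  have ht' : 0 < 1 - t := sub_pos.2 ht1
  have hρd : ρ ∈ density A := ⟨hρ.posSemidef, hρ1⟩
  set σ' : Matrix B B ℂ := (1 - t) • σ + t • maxMixed B with hσ'
  have hσ'p : σ'.PosDef := posDef_mix hσ.1 maxMixed_posDef ht ht1.le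
  have hσ'd : σ' ∈ density B :=
    convex_density hσ maxMixed_mem_density ht'.le ht.le (by ring)
  have hR : ρ ⊗ₖ σ' ∈ density (A × B) := kronecker_mem_density hρd hσ'd
  set τ' : Matrix (A × B) (A × B) ℂ := (1 - t) • τ + t • (ρ ⊗ₖ σ') with hτ'
  have hτ'p : τ'.PosDef := posDef_mix hτ.1 (hρ.kronecker hσ'p) ht ht1.le
  have hτ'd : τ' ∈ density (A × B) := convex_density hτ hR ht'.le ht.le (by ring)
  have hτ'ρ : trRight τ' = ρ := by
    have : trRight τ' = (1 - t) • trRight τ + t • trRight (ρ ⊗ₖ σ') := by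
      ext i j
      simp [hτ', trRight, Finset.sum_add_distrib, Finset.mul_sum]
    rw [this, hτρ, trRight_kronecker, hσ'd.2, one_smul, ← add_smul, sub_add_cancel, one_smul]
  have hk1 : 1 ≤ k := by
    have := re_trace_nonneg h
    rw [trace_sub, trace_smul, (kronecker_mem_density hρd hσ).2, hτ.2] at this
    simpa using this
  set k' := k / (1 - t) with hk'
  have hkk' : k = k' * (1 - t) := by rw [hk']; field_simp
  have hk'1 : 1 ≤ k' := by rw [hk', le_div_iff₀ ht']; linarith
  have h' : ((k' : ℂ) • (ρ ⊗ₖ σ') - τ').PosSemidef := by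
    have e : (k' : ℂ) • (ρ ⊗ₖ σ') - τ' = (1 - t) • ((k : ℂ) • (ρ ⊗ₖ σ) - τ) +
        ((1 - t) * k' * t) • (ρ ⊗ₖ maxMixed B) + (t * (k' - 1)) • (ρ ⊗ₖ σ') := by
      ext ⟨a, b⟩ ⟨a', b'⟩
      simp only [hτ', hσ', Matrix.sub_apply, Matrix.add_apply, Matrix.smul_apply,
        kroneckerMap_apply, smul_eq_mul, Complex.real_smul, hkk']
      push_cast
      ring
    rw [e]
    refine ((h.smul ht'.le).add ((hρ.posSemidef.kronecker maxMixed_posDef.posSemidef).smul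
      ?_)).add (hR.1.smul ?_)
    · positivity
    · exact mul_nonneg ht.le (by linarith)
  obtain ⟨ψ, E, hψ, hE, hE1, hF⟩ := exists_slotProtocol_rootFidelity_ge hM hρ hσ'p hσ'd.2 hτ'p
    hτ'd.2 hτ'ρ (by linarith) h'
  refine ⟨_, ⟨(ψ, E), ⟨hψ, hE, hE1⟩, rfl⟩, ?_⟩
  have hT : IsChannel (slotProtocol (A := A) ψ E) :=
    isChannel_of_mem_eLOCC (protocolMap_mem_eLOCC hψ hE hE1 isChannel_keepSlot)
  have hNd := hN.jointOutput_mem_density hρd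
  have hF1 : (1 - t) * a ≤ rootFidelity (jointOutput N ρ) τ' := by
    have := rootFidelity_combo hτ.1 hR.1 hNd.1 hNd.1 ht'.le ht.le
    rw [← add_smul, sub_add_cancel, one_smul] at this
    rw [rootFidelity_comm hNd.1 hτ'd.1]
    nlinarith [rootFidelity_nonneg (ρ ⊗ₖ σ') (jointOutput N ρ), mul_le_mul_of_nonneg_left haF ht'.le]
  have := rootFidelity_triangle hNd hτ'd (hT.jointOutput_mem_density hρd)
    (mul_nonneg ht'.le ha) hb hF1 (hbk.trans hF)
  rwa [jointOutput_eq_sandwich N, jointOutput_eq_sandwich (slotProtocol ψ E)] at this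

/-- The bound on the smoothed max-divergence gives, for each strictly positive input, slot
protocols with root fidelity arbitrarily close to `√(1 - ε²)`. -/
lemma exists_slotChoi_of_smoothDmax_le [Nonempty B] (hM : 0 < M)
    {N : Matrix A A ℂ →ₗ[ℂ] Matrix B B ℂ} (hN : IsChannel N) {ε δ : ℝ} (hε : ε < 1) (hδ : 0 < δ)
    (hδε : δ < ε) {ρ : Matrix A A ℂ} (hρ : ρ.PosDef) (hρ1 : ρ.trace = 1)
    (h : ⨅ σ ∈ density B, smoothDmax (ε - δ) (jointOutput N ρ) (ρ ⊗ₖ σ) ≤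
      ((Real.log (M * δ ^ 2) : ℝ) : EReal)) {c : ℝ} (hc : c < √(1 - ε ^ 2)) :
    ∃ J ∈ slotChoi A B M, c ≤ choiFidelity ρ (jointOutput N 1) J := by
  have hM' : (0 : ℝ) < M := by exact_mod_cast hM
  set a : ℝ := √(1 - (ε - δ) ^ 2) with ha
  let b : ℝ → ℝ := fun t => 1 - δ ^ 2 / (2 * (1 - t) ^ 2)
  -- `φ t` is the root fidelity guaranteed by mixing weight `t`; in the limit `t → 0` it suffices
  let φ : ℝ → ℝ := fun t =>
    (1 - t) * a * b t - √(1 - ((1 - t) * a) ^ 2) * √(1 - b t ^ 2)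
  have hbc : ContinuousAt b 0 := by
    refine continuousAt_const.sub (continuousAt_const.div (by fun_prop) (by norm_num))
  have hφc : ContinuousAt φ 0 := by
    have h1 : ContinuousAt (fun t : ℝ => (1 - t) * a) 0 := by fun_prop
    exact (h1.mul hbc).sub (((continuousAt_const.sub (h1.pow 2)).sqrt).mul
      ((continuousAt_const.sub (hbc.pow 2)).sqrt))
  have hb0 : 0 < b 0 := by simp only [b]; norm_num; nlinarith
  have hφ0 : c < φ 0 := by
    refine hc.trans_le ?_
    have := sqrt_one_sub_sq_le (η := ε - δ) (δ := δ) (by linarith) hδ.le (by linarith)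
    simpa [φ, b, ← ha] using this
  obtain ⟨t, ⟨⟨hφt, hbt⟩, ht1⟩, ht⟩ : ∃ t, ((c < φ t ∧ 0 < b t) ∧ t < 1) ∧ 0 < t := by
    have e1 := (hφc.eventually (lt_mem_nhds hφ0)).and (hbc.eventually (lt_mem_nhds hb0))
    have e2 := e1.and (gt_mem_nhds (zero_lt_one (α := ℝ)))
    exact ((e2.filter_mono nhdsWithin_le_nhds).and
      (self_mem_nhdsWithin (s := Set.Ioi (0 : ℝ)))).exists
  have ht' : 0 < 1 - t := sub_pos.2 ht1
  have hlt : ⨅ σ ∈ density B, smoothDmax (ε - δ) (jointOutput N ρ) (ρ ⊗ₖ σ) <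
      ((Real.log (M * δ ^ 2 / (1 - t)) : ℝ) : EReal) := by
    refine h.trans_lt (EReal.coe_lt_coe_iff.2 (Real.log_lt_log (by positivity) ?_))
    rw [lt_div_iff₀ ht']
    have : 0 < M * δ ^ 2 := by positivity
    nlinarith
  simp only [smoothDmax, Dmax, iInf_lt_iff] at hlt
  obtain ⟨σ, hσ, τ, ⟨hτ, hτρ, hF⟩, r, hr, hrlt⟩ := hlt
  rw [EReal.coe_lt_coe_iff] at hrlt
  rw [hN.trRight_jointOutput hρ.posSemidef] at hτρ
  have haF : a ≤ rootFidelity τ (jointOutput N ρ) :=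
    Real.sqrt_le_iff.2 ⟨rootFidelity_nonneg _ _, hF⟩
  have hk : Real.exp r < M * δ ^ 2 / (1 - t) := by
    rwa [← Real.lt_log_iff_exp_lt (by positivity)]
  have hbk : b t ≤ 1 - Real.exp r / (1 - t) / (2 * M) := by
    have : Real.exp r / (1 - t) / (2 * M) ≤ M * δ ^ 2 / (1 - t) / (1 - t) / (2 * M) := by gcongr
    have e : M * δ ^ 2 / (1 - t) / (1 - t) / (2 * M) = δ ^ 2 / (2 * (1 - t) ^ 2) := by
      field_simp
    rw [e] at this
    simp only [b]
    linarith
  obtain ⟨J, hJ, hJF⟩ := exists_slotChoi_choiFidelity_ge hM hN hρ hρ1 hσ hτ hτρ (Real.exp_pos r)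
    hr ht ht1 (Real.sqrt_nonneg _) haF hbt.le hbk
  exact ⟨J, hJ, hφt.le.trans hJF⟩

/-- The previous bound extends to singular inputs by convexity in the input. -/
lemma exists_slotChoi_of_forall_posDef [Nonempty A] {N : Matrix A A ℂ →ₗ[ℂ] Matrix B B ℂ}
    (hN : IsChannel N) {c₀ : ℝ}
    (h : ∀ ρ ∈ density A, ρ.PosDef → ∀ c < c₀, ∃ J ∈ slotChoi A B M,
      c ≤ choiFidelity ρ (jointOutput N 1) J)
    {ρ : Matrix A A ℂ} (hρ : ρ ∈ density A) {c : ℝ} (hc : c < c₀) :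
    ∃ J ∈ slotChoi A B M, c ≤ choiFidelity ρ (jointOutput N 1) J := by
  -- the weight `t` of the maximally mixed state costs at most `t` in root fidelity
  obtain ⟨t, ht, ht'⟩ := exists_between (lt_min (sub_pos.2 hc) zero_lt_one)
  obtain ⟨htc, ht1⟩ := lt_min_iff.1 ht'
  have hd := convex_density hρ maxMixed_mem_density (sub_nonneg.2 ht1.le) ht.le (by ring)
  obtain ⟨J, hJ, hJF⟩ := h _ hd (posDef_mix hρ.1 maxMixed_posDef ht ht1.le) (c + t) (by linarith)
  refine ⟨J, hJ, ?_⟩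
  obtain ⟨T, hT, rfl⟩ := convexHull_slotChoi_subset (subset_convexHull ℝ _ hJ)
  have hTc := isChannel_of_mem_eLOCC hT
  have hconv := (convexOn_choiFidelity (hN.jointOutput_posSemidef 1)
    (hTc.jointOutput_posSemidef 1)).2 hρ maxMixed_mem_density (sub_nonneg.2 ht1.le) ht.le (by ring)
  have h1 : choiFidelity (maxMixed A) (jointOutput N 1) (jointOutput T 1) ≤ 1 := by
    rw [choiFidelity, ← jointOutput_eq_sandwich, ← jointOutput_eq_sandwich]
    exact rootFidelity_le_one (hN.jointOutput_mem_density maxMixed_mem_density)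
      (hTc.jointOutput_mem_density maxMixed_mem_density)
  have h0 : 0 ≤ choiFidelity ρ (jointOutput N 1) (jointOutput T 1) := rootFidelity_nonneg _ _
  simp only [smul_eq_mul] at hconv hJF
  nlinarith

/-- The minimax step: protocols that depend on the input yield a single protocol. -/
lemma exists_eLOCC_of_forall_input [Nonempty A] {N : Matrix A A ℂ →ₗ[ℂ] Matrix B B ℂ}
    (hN : IsChannel N) {c₀ : ℝ}
    (h : ∀ ρ ∈ density A, ∀ c < c₀, ∃ J ∈ slotChoi A B M,
      c ≤ choiFidelity ρ (jointOutput N 1) J) :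
    ∃ T ∈ eLOCC A B M, ∀ ρ ∈ density A,
      c₀ ≤ rootFidelity (jointOutput N ρ) (jointOutput T ρ) := by
  have hN1 := hN.jointOutput_posSemidef 1
  have hpos : ∀ J ∈ convexHull ℝ (slotChoi A B M), J.PosSemidef := fun J hJ =>
    posSemidef_of_mem_eLOCCChoi (convexHull_slotChoi_subset hJ)
  obtain ⟨J₁, hJ₁, -⟩ := h _ maxMixed_mem_density (c₀ - 1) (by linarith)
  obtain ⟨ρ₀, hρ₀, J₀, hJ₀, hs⟩ := Sion.exists_isSaddlePointOn
    (X := density A) (Y := convexHull ℝ (slotChoi A B M))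
    (f := fun ρ J => choiFidelity ρ (jointOutput N 1) J)
    ⟨_, maxMixed_mem_density⟩ convex_density isCompact_density
    (fun J hJ => ((continuousOn_choiFidelity_left hN1 (hpos J hJ)).mono
      fun ρ hρ => hρ.1).lowerSemicontinuousOn)
    (fun J hJ => (convexOn_choiFidelity hN1 (hpos J hJ)).quasiconvexOn)
    (convex_convexHull ℝ _) ⟨J₁, subset_convexHull ℝ _ hJ₁⟩ (isCompact_convexHull isCompact_slotChoi)
    (fun ρ _ => ((continuousOn_choiFidelity_right ρ hN1).mono hpos).upperSemicontinuousOn)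
    (fun ρ _ => (concaveOn_choiFidelity ρ hN1 (convex_convexHull ℝ _) hpos).quasiconcaveOn)
  obtain ⟨T, hT, rfl⟩ := convexHull_slotChoi_subset hJ₀
  refine ⟨T, hT, fun ρ hρ => le_of_forall_lt_imp_le_of_dense fun c hc => ?_⟩
  obtain ⟨J, hJ, hJF⟩ := h ρ₀ hρ₀ c hc
  rw [jointOutput_eq_sandwich N, jointOutput_eq_sandwich T]
  exact hJF.trans (hs ρ hρ J (subset_convexHull ℝ _ hJ))

end Simulation

end ChannelSim

end

theorem proposition1 {A B : Type*} [Fintype A] [DecidableEq A] [Nonempty A]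
    [Fintype B] [DecidableEq B] [Nonempty B]
    (N : Matrix A A ℂ →ₗ[ℂ] Matrix B B ℂ) (hN : ChannelSim.IsChannel N)
    (ε δ : ℝ) (hε : ε ∈ Set.Ioo (0 : ℝ) 1) (hδ : δ ∈ Set.Ioo (0 : ℝ) ε)
    (M : ℕ) (hM : 0 < M)
    (h : (⨆ ρ ∈ ChannelSim.density A, ⨅ σ ∈ ChannelSim.density B,
            ChannelSim.smoothDmax (ε - δ) (ChannelSim.jointOutput N ρ) (ρ ⊗ₖ σ))
          - ((Real.log (δ ^ 2) : ℝ) : EReal) ≤ ((Real.log (M : ℝ) : ℝ) : EReal)) :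
    ∃ T ∈ ChannelSim.eLOCC A B M, ∀ ρ ∈ ChannelSim.density A,
      1 - ε ^ 2 ≤ ChannelSim.fidelity (ChannelSim.jointOutput N ρ)
        (ChannelSim.jointOutput T ρ) := by
  have hM' : (M : ℝ) ≠ 0 := by exact_mod_cast hM.ne'
  have hδ' : δ ^ 2 ≠ 0 := pow_ne_zero _ hδ.1.ne'
  rw [EReal.sub_le_iff_le_add (Or.inl (EReal.coe_ne_bot _)) (Or.inl (EReal.coe_ne_top _)),
    ← EReal.coe_add, ← Real.log_mul hM' hδ'] at h
  obtain ⟨T, hT, hTF⟩ := ChannelSim.exists_eLOCC_of_forall_input (M := M) hN fun ρ hρ c hc =>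
    ChannelSim.exists_slotChoi_of_forall_posDef hN (fun ρ hρ hρp c hc =>
      ChannelSim.exists_slotChoi_of_smoothDmax_le hM hN hε.2 hδ.1 hδ.2 hρp hρ.2
        ((le_iSup₂_of_le ρ hρ le_rfl).trans h) hc) hρ hc
  refine ⟨T, hT, fun ρ hρ => ?_⟩
  rw [ChannelSim.fidelity_eq_sq]
  exact (Real.sqrt_le_iff.1 (hTF ρ hρ)).2
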